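/- Consider a dispatcher and $N$ parallel server pools, each with $B$ servers, $B\in\mathbb N\cup\{\infty\}$. Tasks arrive as a Poisson process of rate $\lambda(N)\ge 0$, where $\lambda(N)/N\to\lambda$ for some $\lambda\in[0,\infty)$ as $N\to\infty$. Each arriving task is immediately sent to one of the pools, where it starts execution if fewer than $B$ tasks are active there, and it is discarded otherwise. Execution times are independent and exponentially distributed with unit mean, so that every active task completes at rate $1$ (infinite-server dynamics). Under the JSQ policy an arriving task is sent to a pool with the smallest number of active tasks. Under the JSQ$(d(N))$ scheme, $d(N)\ge 1$, it is sent to a pool with the smallest number of active tasks among $d(N)$ pools that are sampled uniformly at random, for each task anew, either with replacement or, if $d(N)\le N$ for all $N\ge1$, without replacement. Ties are broken arbitrarily, possibly at random, by a rule that depends only on the current numbers of active tasks at the pools and on the sampled pools. Let $Q_i(t)$ denote the number of pools with at least $i$ active tasks at time $t$. For each $N$ let both systems start from the same, arbitrary, initial law on the states with at most $B$ active tasks at every pool. Two schemes $\Pi_1,\Pi_2$ are called $g(N)$-alike if the two sequences of systems, indexed by the number $N$ of pools, can be realized on a common probability space such that, for all $T\ge 0$ and $i\ge 1$, $$\frac{1}{g(N)}\sup_{0\le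 t\le T}\bigl|Q_i^{\Pi_1,N}(t)-Q_i^{\Pi_2,N}(t)\bigr|\to 0\quad\text{in probability as } N\to\infty .$$ Theorem. Let $g$ be a real-valued function on $\mathbb N$ that diverges to infinity, with $g(N)\le N$. Then the JSQ policy and the JSQ$(d(N))$ scheme are $g(N)$-alike in each of the following two cases: (i) $g(N)$ is of the exact order $N$, that is, $g(N)=\Theta(N)$, and $d(N)\to\infty$; (ii) $g(N)=o(N)$ and $d(N)\left(\frac{N}{g(N)}\log\frac{N}{g(N)}\right)^{-1}\to\infty$. -/

import Mathlib

open MeasureTheory Filter Topology Asymptotics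
open scoped NNReal ENNReal

namespace LoadBalancing

/-- The state of a system of `N` parallel server pools: the number of active tasks at each pool. -/
abbrev Config (N : ℕ) : Type := Fin N → ℕ

/-- `occupancy i x` is `Q_i`, the number of server pools with `i` or more active tasks. -/
def occupancy {N : ℕ} (i : ℕ) (x : Config N) : ℕ :=
  (Finset.univ.filter (fun c => i ≤ x c)).card

/-- An assignment scheme: the law of the pool to which an arriving task is sent, given the numbers
of active tasks that it finds at the pools. -/
abbrev Scheme (N : ℕ) : Type := Config N → PMF (Fin N)

/-- The state after a task has been sent to pool `c`. Each pool has `B` servers: the task starts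
execution if fewer than `B` tasks are active at `c`, and is discarded otherwise. -/
noncomputable def addTask {N : ℕ} (B : ℕ∞) (x : Config N) (c : Fin N) : Config N :=
  open Classical in if (x c : ℕ∞) < B then Function.update x c (x c + 1) else x

/-- The state after the completion of a task at pool `c`. -/
def complete {N : ℕ} (x : Config N) (c : Fin N) : Config N :=
  Function.update x c (x c - 1)

/-- The generator of the infinite-server dynamics: tasks arrive as a Poisson process of rate `lam`
and are assigned by the scheme `π`, and every active task completes at rate `1`. -/
noncomputable def generator {N : ℕ} (lam : ℝ≥0) (B : ℕ∞) (π : Scheme N)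
    (f : Config N → ℝ) (x : Config N) : ℝ :=
  (lam : ℝ) * ∑ c, (π x c).toReal * (f (addTask B x c) - f x)
    + ∑ c, (x c : ℝ) * (f (complete x c) - f x)

/-- `X` is (a version of) the continuous-time Markov chain of the numbers of active tasks at the
pools, with arrival rate `lam`, `B` servers per pool, assignment scheme `π` and initial law `ν`:
its paths are almost surely right-continuous step functions with left limits (the state space is
discrete), and it solves the martingale problem of the generator on finitely supported functions.
(Paths with left limits in the discrete state space rule out explosion, so that the law
of `X` is determined.) -/
structure IsTaskProcess {N : ℕ} {Ω : Type*} [mΩ : MeasurableSpace Ω] (P : Measure Ω)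
    (lam : ℝ≥0) (B : ℕ∞) (π : Scheme N) (ν : Measure (Config N))
    (X : ℝ≥0 → Ω → Config N) : Prop where
  measurable : ∀ t, Measurable (X t)
  rightCont : ∀ᵐ ω ∂P, ∀ t, ∀ᶠ s in 𝓝[>] t, X s ω = X t ω
  leftLim : ∀ᵐ ω ∂P, ∀ t, 0 < t → ∃ x, ∀ᶠ s in 𝓝[<] t, X s ω = x
  init : P.map (X 0) = ν
  martingale : ∃ ℱ : Filtration ℝ≥0 mΩ, (∀ t, Measurable[ℱ t] (X t)) ∧
    ∀ f : Config N → ℝ, f.support.Finite →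
      Martingale (fun (t : ℝ≥0) ω =>
        f (X t ω) - ∫ s in (0 : ℝ)..t, generator lam B π f (X s.toNNReal ω)) ℱ P

/-- The JSQ policy: an arriving task is sent to a pool with the smallest number of active tasks
(ties are broken arbitrarily, possibly at random). -/
def IsJSQ {N : ℕ} (π : Scheme N) : Prop :=
  ∀ x, ∀ c ∈ (π x).support, ∀ c', x c ≤ x c'

/-- The two ways of selecting `d` pools uniformly at random. -/
inductive Sampling
  | withReplacement
  | withoutReplacement

/-- The probability that the `d` successively sampled pools are `u 0, …, u (d - 1)`. -/
noncomputable def Sampling.prob {N d : ℕ} (s : Sampling) (u : Fin d → Fin N) : ℝ≥0∞ :=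
  match s with
  | .withReplacement => ((N : ℝ≥0∞) ^ d)⁻¹
  | .withoutReplacement =>
      open Classical in if Function.Injective u then (N.descFactorial d : ℝ≥0∞)⁻¹ else 0

/-- The JSQ(`d`) scheme: `d` pools are sampled uniformly at random, and an arriving task is sent to
a pool with the smallest number of active tasks among the sampled ones (ties are broken
arbitrarily, possibly at random). -/
def IsJSQd {N : ℕ} (s : Sampling) (d : ℕ) (π : Scheme N) : Prop :=
  ∃ choice : Config N → (Fin d → Fin N) → PMF (Fin N),
    (∀ x u, ∀ c ∈ (choice x u).support, c ∈ Set.range u ∧ ∀ j, x c ≤ x (u j)) ∧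
    ∀ x c, π x c = ∑ u : Fin d → Fin N, s.prob u * choice x u c

/-- Two schemes (one for each number `N` of pools) are `g(N)`-alike, in the systems with arrival
rates `lam N`, with `B` servers per pool and with initial laws `ν N`: both sequences of systems can
be realized on a common probability space such that, for all `T` and `i`,
`sup_{t ≤ T} |Q_i(t) - Q'_i(t)| / g(N) → 0` in probability. -/
def Alike (g : ℕ → ℝ) (lam : ℕ → ℝ≥0) (B : ℕ∞) (ν : ∀ N, Measure (Config N))
    (π π' : ∀ N [NeZero N], Scheme N) : Prop :=
  ∃ (Ω : Type) (_ : MeasurableSpace Ω) (P : Measure Ω) (_ : IsProbabilityMeasure P)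
    (X Y : ∀ N, ℝ≥0 → Ω → Config N),
    (∀ N [NeZero N], IsTaskProcess P (lam N) B (π N) (ν N) (X N) ∧
      IsTaskProcess P (lam N) B (π' N) (ν N) (Y N)) ∧
    ∀ (T : ℝ≥0) (i : ℕ), 1 ≤ i →
      TendstoInMeasure P
        (fun N ω => (⨆ t : Set.Iic T,
          |(occupancy i (X N t ω) : ℝ) - (occupancy i (Y N t ω) : ℝ)|) / g N)
        atTop (fun _ => (0 : ℝ))

end LoadBalancing

/-!
The two systems are realized as one Markov jump process. An arrival occurs in both systems at the
same time, and each system assigns it by its own scheme. For the departures, the tasks of each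
system are listed in increasing order of the sizes of their pools, and the `j`-th tasks of the two
lists leave simultaneously.

Write `H_k = Q_1 + ... + Q_k` (`truncLoad`). A departure lowers `H_k` exactly if the task is one of
the first `(k + 1) H_k - k H_{k+1}` of its list (`tasksUpTo_add`, `truncLoad_depart`), and this is
what makes the departures preserve the inequalities
`H_k(JSQ(d)) ≤ H_k(JSQ) ≤ H_k(JSQ(d)) + k n + Δ` for all `k` jointly (`Sandwiched.depart`): where
one of them is an equality, the inequality for `k + 1` orders the two numbers of tasks. Here `Δ`
counts the arrivals that JSQ(`d`) sends to a pool with more than `n` strictly shorter ones. An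
arrival that is not counted preserves the inequalities as well (`Sandwiched.addTask`): if it
raises `H_k` for JSQ only, then at most `n` pools of the other system are below level `k`, and the
gap is at most `k n`. Hence `|Q_i(JSQ) - Q_i(JSQ(d))| ≤ i n + Δ`.

An arrival is counted with probability at most `exp (-n d / N)`, as all sampled pools must miss
more than `n` given ones (`IsJSQd.sum_numShorter_le`). By the martingale of the truncated counter,
`Δ` exceeds `m` by time `T` with probability at most `λ(N) T exp (-n d / N) / m`
(`exists_coupling`). It remains to choose `n = o(g(N))` with `N exp (-n d / N) = o(g(N))`
(`alike_of_tendsto`); `n ≈ N / √d` and `n ≈ g(N) / √w`, with `w` the ratio that diverges in the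
second case, will do.

The jump process itself is built from independent noise: a jump chain with exponential holding
times, which does not explode because the rates grow at most linearly in the number of jumps
(`exists_lt_jumpTime`). Its martingales (`martingale_jumpMartingale`) are sums over the holding
times, each of which contributes zero on average given the noise before it
(`integral_compensatedJump`).
-/

namespace LoadBalancing

/-! ### The standard exponential law -/

lemma expMeasure_one_eq : ProbabilityTheory.expMeasure 1 =
    (volume.restrict (Set.Ioi (0 : ℝ))).withDensity (fun x => ENNReal.ofReal (Real.exp (-x))) := by
  rw [← withDensity_indicator measurableSet_Ioi]
  refine withDensity_congr_ae ?_
  have h0 : ∀ᵐ x : ℝ, x ≠ 0 := by simp [ae_iff, measure_singleton]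
  filter_upwards [h0] with x hx
  rcases lt_or_gt_of_ne hx with h | h
  · rw [ProbabilityTheory.gammaPDF_of_neg h, Set.indicator_of_notMem (by simpa using h.le)]
  · rw [ProbabilityTheory.gammaPDF_of_nonneg h.le, Set.indicator_of_mem (by simpa using h)]
    simp

lemma ae_pos_expMeasure_one : ∀ᵐ e ∂(ProbabilityTheory.expMeasure 1), (0 : ℝ) < e := by
  rw [expMeasure_one_eq]
  exact (withDensity_absolutelyContinuous _ _).ae_le (ae_restrict_mem measurableSet_Ioi)

lemma integral_expMeasure_one (f : ℝ → ℝ) :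
    ∫ e, f e ∂(ProbabilityTheory.expMeasure 1) = ∫ x in Set.Ioi (0 : ℝ), Real.exp (-x) * f x := by
  rw [expMeasure_one_eq, integral_withDensity_eq_integral_toReal_smul (by fun_prop) (by simp)]
  refine integral_congr_ae (Eventually.of_forall fun x => ?_)
  simp [ENNReal.toReal_ofReal (Real.exp_pos _).le]

/-- An exponential clock of rate one, observed until time `b`, rings as often on average as it is
observed in time. This is what makes the compensated jumps centred. -/
lemma integral_ring_sub_min {b : ℝ} (hb : 0 ≤ b) :
    ∫ e, ((if e ≤ b then 1 else 0) - min e b) ∂(ProbabilityTheory.expMeasure 1) = 0 := by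
  rw [integral_expMeasure_one, ← Set.Ioc_union_Ioi_eq_Ioi hb]
  have h1 : Set.EqOn (fun x : ℝ => Real.exp (-x) * ((if x ≤ b then 1 else 0) - min x b))
      (fun x => Real.exp (-x) * (1 - x)) (Set.Ioc 0 b) := fun x hx => by
    simp [hx.2]
  have h2 : Set.EqOn (fun x : ℝ => Real.exp (-x) * ((if x ≤ b then 1 else 0) - min x b))
      (fun x => -b * Real.exp (-x)) (Set.Ioi b) := fun x hx => by
    have hx' : b < x := hx
    simp only [not_le.2 hx', if_false, min_eq_right hx'.le]; ring
  have hc : Continuous fun x : ℝ => Real.exp (-x) * (1 - x) := by fun_prop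
  have hi : IntegrableOn (fun x : ℝ => Real.exp (-x) * ((if x ≤ b then 1 else 0) - min x b))
      (Set.Ioi b) :=
    IntegrableOn.congr_fun ((integrableOn_exp_neg_Ioi b).const_mul (-b)) h2.symm measurableSet_Ioi
  have hdisj : Disjoint (Set.Ioc 0 b) (Set.Ioi b) :=
    Set.disjoint_left.2 fun x hx hx' => not_lt.2 hx.2 hx'
  rw [setIntegral_union hdisj measurableSet_Ioi
    ((hc.integrableOn_Icc.mono_set Set.Ioc_subset_Icc_self).congr_fun h1.symm measurableSet_Ioc)
    hi,
    setIntegral_congr_fun measurableSet_Ioc h1, setIntegral_congr_fun measurableSet_Ioi h2,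
    integral_const_mul, integral_exp_neg_Ioi, ← intervalIntegral.integral_of_le hb,
    intervalIntegral.integral_eq_sub_of_hasDerivAt (f := fun x => x * Real.exp (-x))
      (fun x _ => ?_) (hc.intervalIntegrable _ _)]
  · simp
  · have h : HasDerivAt (fun x => x * Real.exp (-x))
        (1 * Real.exp (-x) + x * (Real.exp (-x) * -1)) x :=
      (hasDerivAt_id x).mul ((Real.hasDerivAt_exp (-x)).comp x (hasDerivAt_neg x))
    exact h.congr_deriv (by ring)

/-! ### Construction of a jump process from independent noise -/

/-- The noise that drives one jump: a state (used by the first noise only, as the initial state),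
a holding time in units of the mean, and for every state the state to which the process would
jump from there. -/
abbrev Noise (S : Type) : Type := S × ℝ × (S → S)

section Construction

variable {S : Type} (R : S → ℝ)

/-- The state after the `n`-th jump and the time of the `n`-th jump, when the holding time in the
state `z` has rate `R z`. -/
noncomputable def jumpChain (ω : ℕ → Noise S) : ℕ → S × ℝ
  | 0 => ((ω 0).1, 0)
  | n + 1 => ((ω (n + 1)).2.2 (jumpChain ω n).1,
      (jumpChain ω n).2 + max (ω (n + 1)).2.1 0 / R (jumpChain ω n).1)

/-- The path that follows the jump chain and is frozen from the `n`-th jump on. -/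
noncomputable def frozenPath (ω : ℕ → Noise S) : ℕ → ℝ → S
  | 0, _ => (jumpChain R ω 0).1
  | n + 1, t => if (jumpChain R ω (n + 1)).2 ≤ t then (jumpChain R ω (n + 1)).1
      else frozenPath ω n t

open Classical in
/-- The first stage by which the path up to time `t` is determined (`0` if there is none). -/
noncomputable def stage (ω : ℕ → Noise S) (t : ℝ) : ℕ :=
  if h : ∃ n, t < (jumpChain R ω (n + 1)).2 then Nat.find h else 0

/-- The jump process driven by the noise `ω`. -/
noncomputable def jumpPath (ω : ℕ → Noise S) (t : ℝ) : S := frozenPath R ω (stage R ω t) t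

/-- The noise stopped at time `n`. -/
def stopNoise (n : ℕ) (ω : ℕ → Noise S) : ℕ → Noise S := fun i => if i ≤ n then ω i else ω 0

variable {R}

lemma jumpChain_stopNoise (ω : ℕ → Noise S) {m n : ℕ} (h : m ≤ n) :
    jumpChain R (stopNoise n ω) m = jumpChain R ω m := by
  induction m with
  | zero => simp [jumpChain, stopNoise]
  | succ m ih => simp only [jumpChain, ih (Nat.le_of_succ_le h)]; simp [stopNoise, h]

lemma frozenPath_stopNoise (ω : ℕ → Noise S) {m n : ℕ} (h : m ≤ n) :
    frozenPath R (stopNoise n ω) m = frozenPath R ω m := by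
  induction m with
  | zero => ext t; simp [frozenPath, jumpChain_stopNoise]
  | succ m ih =>
    ext t; simp only [frozenPath, jumpChain_stopNoise ω h, ih (Nat.le_of_succ_le h)]

variable (hR : ∀ z, 0 < R z)
include hR

lemma jumpTime_mono (ω : ℕ → Noise S) : Monotone fun n => (jumpChain R ω n).2 :=
  monotone_nat_of_le_succ fun n => by
    simp only [jumpChain]
    have := div_nonneg (le_max_right (ω (n + 1)).2.1 0) (hR (jumpChain R ω n).1).le
    linarith

omit hR in
lemma frozenPath_of_le (ω : ℕ → Noise S) {n : ℕ} {t : ℝ} (h : (jumpChain R ω n).2 ≤ t) :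
    frozenPath R ω n t = (jumpChain R ω n).1 := by
  cases n with
  | zero => rfl
  | succ n => simp [frozenPath, h]

lemma frozenPath_of_lt (ω : ℕ → Noise S) {m n : ℕ} (hmn : m ≤ n) {t : ℝ}
    (h : t < (jumpChain R ω (m + 1)).2) : frozenPath R ω n t = frozenPath R ω m t := by
  induction n, hmn using Nat.le_induction with
  | base => rfl
  | succ n hmn ih =>
    have := jumpTime_mono hR ω (Nat.succ_le_succ hmn)
    simp only [frozenPath]
    rw [if_neg (not_le.2 (h.trans_le this)), ih]

lemma jumpPath_eq (ω : ℕ → Noise S) {n : ℕ} {t : ℝ} (h : t < (jumpChain R ω (n + 1)).2) :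
    jumpPath R ω t = frozenPath R ω n t := by
  classical
  have hex : ∃ n, t < (jumpChain R ω (n + 1)).2 := ⟨n, h⟩
  have hs : stage R ω t = Nat.find hex := by simp [stage, hex]
  rw [jumpPath, hs]
  exact (frozenPath_of_lt hR ω (Nat.find_min' hex h) (Nat.find_spec hex)).symm

omit hR in
lemma frozenPath_rightCont (ω : ℕ → Noise S) (n : ℕ) (t : ℝ≥0) :
    ∀ᶠ s : ℝ≥0 in 𝓝[>] t, frozenPath R ω n s = frozenPath R ω n t := by
  induction n with
  | zero => simp [frozenPath]
  | succ n ih =>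
    by_cases h : (jumpChain R ω (n + 1)).2 ≤ t
    · filter_upwards [self_mem_nhdsWithin] with s hs
      have : (t : ℝ) < s := hs
      simp [frozenPath, h, h.trans this.le]
    · have h1 : ∀ᶠ s : ℝ≥0 in 𝓝[>] t, (s : ℝ) < (jumpChain R ω (n + 1)).2 :=
        nhdsWithin_le_nhds ((NNReal.continuous_coe.tendsto t).eventually_lt_const (not_le.1 h))
      filter_upwards [h1, ih] with s hs hs'
      simp only [frozenPath]
      rw [if_neg (not_le.2 hs), if_neg h, hs']

omit hR in
lemma frozenPath_leftLim (ω : ℕ → Noise S) (n : ℕ) (t : ℝ≥0) :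
    ∃ z, ∀ᶠ s : ℝ≥0 in 𝓝[<] t, frozenPath R ω n s = z := by
  induction n with
  | zero => exact ⟨(jumpChain R ω 0).1, Eventually.of_forall fun _ => rfl⟩
  | succ n ih =>
    by_cases h : (jumpChain R ω (n + 1)).2 < t
    · have h1 : ∀ᶠ s : ℝ≥0 in 𝓝[<] t, (jumpChain R ω (n + 1)).2 < (s : ℝ) :=
        nhdsWithin_le_nhds ((NNReal.continuous_coe.tendsto t).eventually_const_lt h)
      refine ⟨(jumpChain R ω (n + 1)).1, ?_⟩
      filter_upwards [h1] with s hs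
      simp [frozenPath, hs.le]
    · obtain ⟨z, hz⟩ := ih
      refine ⟨z, ?_⟩
      filter_upwards [hz, self_mem_nhdsWithin] with s hs hs'
      have h3 : (s : ℝ) < t := hs'
      simp only [frozenPath]
      rw [if_neg (by linarith), hs]

/-- A preorder that is respected by all jumps is respected along the path. -/
lemma jumpPath_rel {ρ : S → S → Prop} (hrefl : ∀ z, ρ z z)
    (htrans : ∀ a b c, ρ a b → ρ b c → ρ a c) {ω : ℕ → Noise S}
    (hω : ∀ n z, ρ z ((ω (n + 1)).2.2 z)) (hT : ∀ t : ℝ, ∃ n, t < (jumpChain R ω (n + 1)).2)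
    {s t : ℝ} (hst : s ≤ t) : ρ (jumpPath R ω s) (jumpPath R ω t) := by
  obtain ⟨n, hn⟩ := hT t
  rw [jumpPath_eq hR ω hn, jumpPath_eq hR ω (hst.trans_lt hn)]
  have hchain : ∀ n u, ρ (frozenPath R ω n u) (jumpChain R ω n).1 := fun n => by
    induction n with
    | zero => intro u; exact hrefl _
    | succ n ih =>
      intro u
      simp only [frozenPath]
      split_ifs
      · exact hrefl _
      · exact htrans _ _ _ (ih u) (hω n _)
  clear hn
  induction n with
  | zero => exact hrefl _
  | succ n ih =>
    simp only [frozenPath]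
    split_ifs with h1 h2 h2
    · exact hrefl _
    · linarith
    · exact htrans _ _ _ (hchain n s) (hω n _)
    · exact ih

omit hR in
variable [MeasurableSpace S] in
lemma measurable_stopNoise (n : ℕ) : Measurable (stopNoise (S := S) n) :=
  measurable_pi_lambda _ fun i => by
    unfold stopNoise; split_ifs <;> exact measurable_pi_apply _

omit hR
variable [Countable S] [MeasurableSpace S] [MeasurableSingletonClass S]

lemma measurable_apply_fun : Measurable fun p : (S → S) × S => p.1 p.2 :=
  measurable_from_prod_countable_left fun z => measurable_pi_apply z

lemma measurable_jumpChain (n : ℕ) : Measurable fun ω : ℕ → Noise S => jumpChain R ω n := by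
  have hRm : Measurable R := measurable_of_countable R
  induction n with
  | zero => exact (measurable_fst.comp (measurable_pi_apply 0)).prodMk measurable_const
  | succ n ih =>
    have h1 : Measurable fun ω : ℕ → Noise S => (ω (n + 1)).2.2 :=
      (measurable_snd.comp measurable_snd).comp (measurable_pi_apply (n + 1))
    have h2 : Measurable fun ω : ℕ → Noise S => (ω (n + 1)).2.1 :=
      (measurable_fst.comp measurable_snd).comp (measurable_pi_apply (n + 1))
    simp only [jumpChain]
    exact (measurable_apply_fun.comp (h1.prodMk ih.fst)).prodMk
      (ih.snd.add ((h2.max measurable_const).div (hRm.comp ih.fst)))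

lemma measurable_frozenPath (n : ℕ) :
    Measurable fun p : ℝ × (ℕ → Noise S) => frozenPath R p.2 n p.1 := by
  induction n with
  | zero => exact (measurable_jumpChain 0).fst.comp measurable_snd
  | succ n ih =>
    simp only [frozenPath]
    have h := (measurable_jumpChain (R := R) (n + 1)).comp
      (measurable_snd : Measurable (Prod.snd : ℝ × (ℕ → Noise S) → _))
    exact Measurable.ite (measurableSet_le h.snd measurable_fst) h.fst ih

lemma measurable_jumpPath :
    Measurable fun p : ℝ × (ℕ → Noise S) => jumpPath R p.2 p.1 := by
  classical
  have hlt : ∀ n, MeasurableSet {p : ℝ × (ℕ → Noise S) | p.1 < (jumpChain R p.2 (n + 1)).2} :=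
    fun n => measurableSet_lt measurable_fst
      ((measurable_jumpChain (R := R) (n + 1)).comp measurable_snd).snd
  -- stage `0` is declared to be the last one when the jump times are bounded by the time
  have hex : ∀ p : ℝ × (ℕ → Noise S), ∃ n, p.1 < (jumpChain R p.2 (n + 1)).2 ∨
      ∀ m, ¬ p.1 < (jumpChain R p.2 (m + 1)).2 := fun p => by
    by_cases h : ∃ n, p.1 < (jumpChain R p.2 (n + 1)).2
    · exact ⟨h.choose, Or.inl h.choose_spec⟩
    · exact ⟨0, Or.inr fun m hm => h ⟨m, hm⟩⟩
  have hm := Measurable.find (f := fun n (p : ℝ × (ℕ → Noise S)) => frozenPath R p.2 n p.1)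
    (fun n => measurable_frozenPath n) (fun n => (hlt n).union
      (MeasurableSet.iInter fun m => (hlt m).compl) |> fun h => by
        convert h using 1; ext p; simp) hex
  convert hm using 2 with p
  rw [jumpPath]
  congr 1
  rw [stage]
  split_ifs with h
  · refine le_antisymm (Nat.find_min' h ?_) (Nat.find_min' _ (Or.inl (Nat.find_spec h)))
    exact (Nat.find_spec (hex p)).resolve_right fun hn => hn _ h.choose_spec
  · exact ((Nat.find_eq_zero _).2 (Or.inr fun m hm => h ⟨m, hm⟩)).symm

end Construction

/-! ### The law of the noise -/

section Law

instance : IsProbabilityMeasure (ProbabilityTheory.expMeasure 1) :=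
  ProbabilityTheory.isProbabilityMeasure_expMeasure one_pos

variable {S : Type} [MeasurableSpace S] (μ₀ : Measure S) [IsProbabilityMeasure μ₀]
  (K : S → Measure S) [∀ z, IsProbabilityMeasure (K z)]

/-- The law of one noise: an initial state of law `μ₀`, a standard exponential holding time, and
a jump from every state `z` of law `K z`, all of them independent. -/
noncomputable def noiseLaw : Measure (Noise S) :=
  μ₀.prod ((ProbabilityTheory.expMeasure 1).prod (Measure.infinitePi K))

instance : IsProbabilityMeasure (noiseLaw μ₀ K) := by unfold noiseLaw; infer_instance

/-- The law of an independent sequence of noises. -/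
noncomputable def jumpLaw : Measure (ℕ → Noise S) := Measure.infinitePi fun _ => noiseLaw μ₀ K

instance : IsProbabilityMeasure (jumpLaw μ₀ K) := by unfold jumpLaw; infer_instance

lemma map_jumpLaw_eval (n : ℕ) : (jumpLaw μ₀ K).map (fun ω => ω n) = noiseLaw μ₀ K :=
  Measure.infinitePi_map_eval _ n

omit [IsProbabilityMeasure μ₀] in
lemma map_noiseLaw_init : (noiseLaw μ₀ K).map Prod.fst = μ₀ := by
  simp [noiseLaw]

lemma map_noiseLaw_exp :
    (noiseLaw μ₀ K).map (fun w => w.2.1) = ProbabilityTheory.expMeasure 1 := by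
  have h : (fun w : Noise S => w.2.1) = Prod.fst ∘ Prod.snd := rfl
  rw [h, ← Measure.map_map measurable_fst measurable_snd, noiseLaw, Measure.map_snd_prod]
  simp

lemma map_noiseLaw_jump (z : S) : (noiseLaw μ₀ K).map (fun w => w.2.2 z) = K z := by
  have h : (fun w : Noise S => w.2.2 z) = (fun u : S → S => u z) ∘ Prod.snd ∘ Prod.snd := rfl
  rw [h, ← Measure.map_map (measurable_pi_apply z) (measurable_snd.comp measurable_snd),
    ← Measure.map_map measurable_snd measurable_snd, noiseLaw, Measure.map_snd_prod]
  simp [Measure.map_snd_prod, Measure.infinitePi_map_eval]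

lemma ae_jumpLaw_of_noiseLaw {p : Noise S → Prop} (h : ∀ᵐ w ∂(noiseLaw μ₀ K), p w) (n : ℕ) :
    ∀ᵐ ω ∂(jumpLaw μ₀ K), p (ω n) := by
  rw [← map_jumpLaw_eval μ₀ K n] at h
  exact ae_of_ae_map (measurable_pi_apply n).aemeasurable h

lemma ae_forall_exp_pos : ∀ᵐ ω ∂(jumpLaw μ₀ K), ∀ n, 0 < (ω n).2.1 := by
  refine ae_all_iff.2 fun n => ae_jumpLaw_of_noiseLaw μ₀ K (p := fun w => 0 < w.2.1) ?_ n
  have h := ae_pos_expMeasure_one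
  rw [← map_noiseLaw_exp μ₀ K] at h
  exact ae_of_ae_map (by fun_prop) h

lemma ae_forall_jump [Countable S] {ρ : S → S → Prop} (h : ∀ z, ∀ᵐ z' ∂(K z), ρ z z') :
    ∀ᵐ ω ∂(jumpLaw μ₀ K), ∀ n z, ρ z ((ω n).2.2 z) := by
  refine ae_all_iff.2 fun n => ae_all_iff.2 fun z =>
    ae_jumpLaw_of_noiseLaw μ₀ K (p := fun w => ρ z (w.2.2 z)) ?_ n
  have h := h z
  rw [← map_noiseLaw_jump μ₀ K z] at h
  refine ae_of_ae_map (Measurable.aemeasurable ?_) h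
  exact (measurable_pi_apply z).comp (measurable_snd.comp measurable_snd)

lemma iIndepFun_jumpLaw {β : Type*} [MeasurableSpace β] {f : Noise S → β} (hf : Measurable f) :
    ProbabilityTheory.iIndepFun (fun n ω => f (ω n)) (jumpLaw μ₀ K) :=
  ProbabilityTheory.iIndepFun_infinitePi (X := fun _ => f) fun _ => hf

/-- The next noise is independent of the past. -/
lemma map_stopNoise_prod (n : ℕ) :
    (jumpLaw μ₀ K).map (fun ω => (stopNoise n ω, ω (n + 1))) =
      ((jumpLaw μ₀ K).map (stopNoise n)).prod (noiseLaw μ₀ K) := by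
  have h1 := (iIndepFun_jumpLaw μ₀ K measurable_id).indepFun_finset (Finset.Iic n) {n + 1}
    (by simp) (fun i => measurable_pi_apply i)
  let φ : (Finset.Iic n → Noise S) → (ℕ → Noise S) := fun v i =>
    if h : i ≤ n then v ⟨i, by simpa using h⟩ else v ⟨0, by simp⟩
  have hφ : Measurable φ := measurable_pi_lambda _ fun i => by
    by_cases h : i ≤ n <;> simp only [φ, h, dite_true, dite_false] <;> exact measurable_pi_apply _
  let ψ : (({n + 1} : Finset ℕ) → Noise S) → Noise S := fun v => v ⟨n + 1, by simp⟩
  have hψ : Measurable ψ := measurable_pi_apply _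
  have h2 := h1.comp (φ := φ) (ψ := ψ) hφ hψ
  have h3 : φ ∘ (fun (ω : ℕ → Noise S) (i : Finset.Iic n) => id (ω i)) = stopNoise n := by
    ext1 ω; funext i
    simp [φ, stopNoise]
  have h4 : ψ ∘ (fun (ω : ℕ → Noise S) (i : ({n + 1} : Finset ℕ)) => id (ω i)) =
      fun ω => ω (n + 1) := rfl
  rw [h3, h4] at h2
  rw [(ProbabilityTheory.indepFun_iff_map_prod_eq_prod_map_map
    (measurable_stopNoise n).aemeasurable (measurable_pi_apply (n + 1)).aemeasurable).1 h2,
    map_jumpLaw_eval]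

lemma setIntegral_next_eq_zero {n : ℕ} {g : (ℕ → Noise S) → Noise S → ℝ}
    (hg : Measurable fun p : (ℕ → Noise S) × Noise S => g p.1 p.2) {C : ℝ}
    (hC : ∀ ω w, |g ω w| ≤ C) (h0 : ∀ ω, ∫ w, g ω w ∂(noiseLaw μ₀ K) = 0)
    {A : Set (ℕ → Noise S)} (hA : MeasurableSet A) :
    ∫ ω in stopNoise n ⁻¹' A, g (stopNoise n ω) (ω (n + 1)) ∂(jumpLaw μ₀ K) = 0 := by
  have hm := measurable_stopNoise (S := S) n
  let g' : (ℕ → Noise S) × Noise S → ℝ := (A ×ˢ Set.univ).indicator fun p => g p.1 p.2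
  have hg' : Measurable g' := hg.indicator (hA.prod MeasurableSet.univ)
  have hp : Measurable fun ω : ℕ → Noise S => (stopNoise n ω, ω (n + 1)) :=
    hm.prodMk (measurable_pi_apply _)
  have : IsProbabilityMeasure ((jumpLaw μ₀ K).map (stopNoise n)) :=
    Measure.isProbabilityMeasure_map hm.aemeasurable
  rw [← integral_indicator (hm hA)]
  have h1 : (stopNoise n ⁻¹' A).indicator (fun ω => g (stopNoise n ω) (ω (n + 1))) =
      fun ω => g' (stopNoise n ω, ω (n + 1)) := by
    ext ω; by_cases h : stopNoise n ω ∈ A <;> simp [g', h]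
  have hint : Integrable g' (((jumpLaw μ₀ K).map (stopNoise n)).prod (noiseLaw μ₀ K)) :=
    Integrable.of_bound hg'.aestronglyMeasurable C (Eventually.of_forall fun p => by
      have := hC p.1 p.2
      simp only [g', Set.indicator]; split_ifs
      · exact this
      · simpa using (abs_nonneg _).trans this)
  rw [h1, ← integral_map (f := g') hp.aemeasurable hg'.aestronglyMeasurable, map_stopNoise_prod,
    integral_prod _ hint]
  refine integral_eq_zero_of_ae (Eventually.of_forall fun ω => ?_)
  by_cases h : ω ∈ A
  · simpa [g', h] using h0 ω
  · simp [g', h]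

end Law

/-! ### Absence of explosions -/

/-- If the holding rates grow at most linearly in the number of jumps, the partial sums of the
holding times are unbounded, as the law of large numbers bounds every block from below. -/
lemma exists_lt_jumpTime {S : Type} {R : S → ℝ} (hR : ∀ z, 0 < R z) {ω : ℕ → Noise S} {c m : ℝ}
    (hc : 0 ≤ c) (hω : ∀ n z, R ((ω (n + 1)).2.2 z) ≤ R z + c) (hm : 0 < m)
    (hlim : Tendsto (fun n : ℕ => (∑ i ∈ Finset.range n, max (min (ω i).2.1 1) 0) / n) atTop
      (𝓝 m)) (t : ℝ) : ∃ n, t < (jumpChain R ω (n + 1)).2 := by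
  by_contra! hcon
  set T : ℕ → ℝ := fun n => (jumpChain R ω n).2 with hT
  set φ : ℕ → ℝ := fun i => max (min (ω i).2.1 1) 0 with hφ
  set r := R (jumpChain R ω 0).1 with hr
  have hr0 : 0 < r := hR _
  have hmono : Monotone T := jumpTime_mono hR ω
  have hgrow : ∀ n : ℕ, R (jumpChain R ω n).1 ≤ r + c * n := fun n => by
    induction n with
    | zero => simp [hr]
    | succ n ih =>
      have := hω n (jumpChain R ω n).1
      simp only [jumpChain]; push_cast; linarith
  -- the holding times of the block from `n + 1` to `2 n`
  have hstep : ∀ k n : ℕ, k ≤ n → φ (k + 1) ≤ (r + c * n) * (T (k + 1) - T k) := fun k n hkn => by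
    have h1 : T (k + 1) - T k = max (ω (k + 1)).2.1 0 / R (jumpChain R ω k).1 := by
      simp [hT, jumpChain]
    have h2 : φ (k + 1) ≤ max (ω (k + 1)).2.1 0 := max_le_max (min_le_left _ _) le_rfl
    have h3 : R (jumpChain R ω k).1 ≤ r + c * n := (hgrow k).trans (by gcongr)
    have h4 := hR (jumpChain R ω k).1
    rw [h1]
    calc φ (k + 1) ≤ max (ω (k + 1)).2.1 0 := h2
      _ = R (jumpChain R ω k).1 * (max (ω (k + 1)).2.1 0 / R (jumpChain R ω k).1) := by
        field_simp
      _ ≤ _ := by gcongr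
  have hbdd : BddAbove (Set.range T) := ⟨t, by
    rintro _ ⟨n, rfl⟩; exact (hmono n.le_succ).trans (hcon n)⟩
  have hconv := tendsto_atTop_ciSup hmono hbdd
  have hdouble : Tendsto (fun n : ℕ => 2 * n) atTop atTop :=
    tendsto_id.const_mul_atTop' (by norm_num)
  have hdiff : Tendsto (fun n : ℕ => T (2 * n) - T n) atTop (𝓝 0) := by
    simpa using (hconv.comp hdouble).sub hconv
  set A : ℕ → ℝ := fun n => ∑ i ∈ Finset.range (n + 1), φ i with hA
  have hblock : ∀ n : ℕ, A (2 * n) - A n ≤ (r + c * (2 * n : ℕ)) * (T (2 * n) - T n) := fun n => by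
    have : ∀ k, n ≤ k → k ≤ 2 * n → A k - A n ≤ (r + c * (2 * n : ℕ)) * (T k - T n) := by
      intro k hk
      induction k, hk using Nat.le_induction with
      | base => intro _; simp
      | succ k hk ih =>
        intro hk2
        have h1 := ih (by omega)
        have h2 := hstep k (2 * n) (by omega)
        have h3 : A (k + 1) = A k + φ (k + 1) := Finset.sum_range_succ _ _
        rw [h3]; linarith
    exact this _ (by omega) le_rfl
  have hlim' : Tendsto (fun n : ℕ => A n / n) atTop (𝓝 m) := by
    have h1 := hlim.comp (tendsto_add_atTop_nat 1)
    have h2 : Tendsto (fun n : ℕ => ((n + 1 : ℕ) : ℝ) / n) atTop (𝓝 1) := by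
      have h : Tendsto (fun n : ℕ => 1 + 1 / (n : ℝ)) atTop (𝓝 (1 + 0)) :=
        tendsto_const_nhds.add tendsto_one_div_atTop_nhds_zero_nat
      rw [add_zero] at h
      refine h.congr' ?_
      filter_upwards [eventually_gt_atTop 0] with n hn
      have : (n : ℝ) ≠ 0 := by positivity
      push_cast; field_simp
    have h3 := h1.mul h2
    rw [mul_one] at h3
    refine h3.congr fun n => ?_
    have : ((n + 1 : ℕ) : ℝ) ≠ 0 := by positivity
    simp only [Function.comp, hA]
    field_simp
  have hleft : Tendsto (fun n : ℕ => 2 * (A (2 * n) / (2 * n : ℕ)) - A n / n) atTop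
      (𝓝 (2 * m - m)) := ((hlim'.comp hdouble).const_mul 2).sub hlim'
  have hright : Tendsto (fun n : ℕ => (r + 2 * c) * (T (2 * n) - T n)) atTop (𝓝 0) := by
    simpa using hdiff.const_mul (r + 2 * c)
  have := le_of_tendsto_of_tendsto hleft hright (by
    filter_upwards [eventually_gt_atTop 0] with n hn
    have hn' : (1 : ℝ) ≤ n := by exact_mod_cast hn
    have h1 := hblock n
    have h2 : 0 ≤ T (2 * n) - T n := sub_nonneg.2 (hmono (by omega))
    have h3 : 2 * (A (2 * n) / (2 * n : ℕ)) - A n / n = (A (2 * n) - A n) / n := by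
      push_cast; field_simp
    rw [h3, div_le_iff₀ (by linarith)]
    refine h1.trans ?_
    have h4 : r + c * (2 * n : ℕ) ≤ (r + 2 * c) * n := by push_cast; nlinarith
    calc _ ≤ ((r + 2 * c) * n) * (T (2 * n) - T n) := by gcongr
      _ = _ := by ring)
  linarith

lemma ae_exists_lt_jumpTime {S : Type} [Countable S] [MeasurableSpace S]
    (μ₀ : Measure S) [IsProbabilityMeasure μ₀]
    (K : S → Measure S) [∀ z, IsProbabilityMeasure (K z)] {R : S → ℝ} (hR : ∀ z, 0 < R z)
    {c : ℝ} (hc : 0 ≤ c) (hK : ∀ z, ∀ᵐ z' ∂(K z), R z' ≤ R z + c) :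
    ∀ᵐ ω ∂(jumpLaw μ₀ K), ∀ t, ∃ n, t < (jumpChain R ω (n + 1)).2 := by
  let f : Noise S → ℝ := fun w => max (min w.2.1 1) 0
  have hf : Measurable f :=
    ((measurable_fst.comp measurable_snd).min measurable_const).max measurable_const
  have hfb : ∀ w, |f w| ≤ 1 := fun w => by
    simp only [f]; rw [abs_of_nonneg (le_max_right _ _)]
    exact max_le (min_le_right _ _) zero_le_one
  have hind := iIndepFun_jumpLaw μ₀ K hf
  have hint : Integrable (fun ω : ℕ → Noise S => f (ω 0)) (jumpLaw μ₀ K) :=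
    Integrable.of_bound (hf.comp (measurable_pi_apply 0)).aestronglyMeasurable 1
      (Eventually.of_forall fun ω => hfb _)
  have hslln := ProbabilityTheory.strong_law_ae_real (fun n (ω : ℕ → Noise S) => f (ω n)) hint
    (fun i j hij => hind.indepFun hij) (fun i =>
      ⟨(hf.comp (measurable_pi_apply i)).aemeasurable, (hf.comp (measurable_pi_apply 0)).aemeasurable,
        by
          have : ∀ j, (jumpLaw μ₀ K).map (fun ω => f (ω j)) = (noiseLaw μ₀ K).map f := fun j => by
            rw [← map_jumpLaw_eval μ₀ K j, Measure.map_map hf (measurable_pi_apply j)]; rfl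
          rw [this, this]⟩)
  have hpos : 0 < ∫ ω, f (ω 0) ∂(jumpLaw μ₀ K) := by
    have hnn : 0 ≤ fun ω : ℕ → Noise S => f (ω 0) := fun ω => le_max_right _ _
    rw [integral_pos_iff_support_of_nonneg hnn hint]
    have : ∀ᵐ ω ∂(jumpLaw μ₀ K), ω ∈ Function.support fun ω : ℕ → Noise S => f (ω 0) := by
      filter_upwards [ae_forall_exp_pos μ₀ K] with ω hω
      exact (lt_max_of_lt_left (lt_min (hω 0) one_pos)).ne'
    have h1 : jumpLaw μ₀ K (Function.support fun ω => f (ω 0)) = jumpLaw μ₀ K Set.univ :=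
      measure_congr (eventuallyEq_univ.2 this)
    simp [h1]
  filter_upwards [hslln, ae_forall_jump μ₀ K hK] with ω h1 h2
  exact fun t => exists_lt_jumpTime hR hc (fun n z => h2 (n + 1) z) hpos h1 t

/-! ### The martingales of a jump process -/

lemma intervalIntegrable_of_abs_le {f : ℝ → ℝ} (hf : Measurable f) {C : ℝ}
    (hC : ∀ x, |f x| ≤ C) (a b : ℝ) : IntervalIntegrable f volume a b :=
  (intervalIntegrable_const (c := C)).mono_fun' hf.aestronglyMeasurable
    (Eventually.of_forall hC)

section Martingale

variable {S : Type} [MeasurableSpace S]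

/-- The generator of the jump process with holding rates `R` and jump laws `K`. -/
noncomputable def jumpGenerator (R : S → ℝ) (K : S → Measure S) (F : S → ℝ) (z : S) : ℝ :=
  R z * (∫ z', F z' ∂(K z) - F z)

/-- The contribution of one holding time and of the jump that ends it to the martingale of `F` at
time `t`, when the holding time starts at the time `p.2` in the state `p.1`. -/
noncomputable def compensatedJump (R : S → ℝ) (K : S → Measure S) (F : S → ℝ) (t : ℝ)
    (p : S × ℝ) (w : Noise S) : ℝ :=
  (if p.2 + max w.2.1 0 / R p.1 ≤ t then F (w.2.2 p.1) - F p.1 else 0) -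
    jumpGenerator R K F p.1 * (min t (p.2 + max w.2.1 0 / R p.1) - min t p.2)

variable [Countable S] [MeasurableSingletonClass S]
  (μ₀ : Measure S) [IsProbabilityMeasure μ₀]
  (K : S → Measure S) {R : S → ℝ} (hR : ∀ z, 0 < R z) {F : S → ℝ} {C D : ℝ}

omit [Countable S] [MeasurableSingletonClass S] in
include hR in
lemma abs_compensatedJump_le (hC : ∀ z, |F z| ≤ C) (hD : ∀ z, |jumpGenerator R K F z| ≤ D)
    {t : ℝ} {p : S × ℝ} (hp : 0 ≤ p.2) (w : Noise S) :
    |compensatedJump R K F t p w| ≤ 2 * C + D * |t| := by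
  have hD0 : 0 ≤ D := (abs_nonneg _).trans (hD p.1)
  have hC0 : 0 ≤ C := (abs_nonneg _).trans (hC p.1)
  have he : 0 ≤ max w.2.1 0 / R p.1 := div_nonneg (le_max_right _ _) (hR p.1).le
  have h1 : |if p.2 + max w.2.1 0 / R p.1 ≤ t then F (w.2.2 p.1) - F p.1 else 0| ≤ 2 * C := by
    split_ifs
    · have := abs_sub (F (w.2.2 p.1)) (F p.1)
      linarith [hC (w.2.2 p.1), hC p.1]
    · simpa using hC0
  have h2 : |min t (p.2 + max w.2.1 0 / R p.1) - min t p.2| ≤ |t| := by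
    rw [abs_of_nonneg (sub_nonneg.2 (min_le_min le_rfl (by linarith)))]
    have h3 := neg_abs_le t
    have h4 := le_abs_self t
    rcases le_total t p.2 with h | h
    · have := min_le_left t (p.2 + max w.2.1 0 / R p.1)
      rw [min_eq_left h]; linarith [abs_nonneg t]
    · have := min_le_left t (p.2 + max w.2.1 0 / R p.1)
      rw [min_eq_right h]; linarith
  refine (abs_sub _ _).trans (add_le_add h1 ?_)
  rw [abs_mul]
  exact mul_le_mul (hD _) h2 (abs_nonneg _) hD0

lemma measurable_compensatedJump (t : ℝ) :
    Measurable fun q : (S × ℝ) × Noise S => compensatedJump R K F t q.1 q.2 := by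
  have hRm : Measurable R := measurable_of_countable R
  have hFm : Measurable F := measurable_of_countable F
  have hGm : Measurable (jumpGenerator R K F) := measurable_of_countable _
  have hz : Measurable fun q : (S × ℝ) × Noise S => q.1.1 := measurable_fst.fst
  have hT : Measurable fun q : (S × ℝ) × Noise S => q.1.2 := measurable_fst.snd
  have he : Measurable fun q : (S × ℝ) × Noise S => q.2.2.1 := measurable_snd.snd.fst
  have hu : Measurable fun q : (S × ℝ) × Noise S => q.2.2.2 := measurable_snd.snd.snd
  have hT' : Measurable fun q : (S × ℝ) × Noise S => q.1.2 + max q.2.2.1 0 / R q.1.1 :=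
    hT.add ((he.max measurable_const).div (hRm.comp hz))
  refine Measurable.sub (Measurable.ite (measurableSet_le hT' measurable_const) ?_
    measurable_const) ((hGm.comp hz).mul ((measurable_const.min hT').sub
      (measurable_const.min hT)))
  exact (hFm.comp (measurable_apply_fun.comp (hu.prodMk hz))).sub (hFm.comp hz)

include hR in
/-- Given the state and the time at its start, a holding time contributes zero on average. -/
lemma integral_compensatedJump [∀ z, IsProbabilityMeasure (K z)]
    (hC : ∀ z, |F z| ≤ C) (hD : ∀ z, |jumpGenerator R K F z| ≤ D)
    (t : ℝ) {p : S × ℝ} (hp : 0 ≤ p.2) :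
    ∫ w, compensatedJump R K F t p w ∂(noiseLaw μ₀ K) = 0 := by
  have hm : Measurable fun w => compensatedJump R K F t p w :=
    (measurable_compensatedJump K t).comp (measurable_const.prodMk measurable_id)
  have hint : Integrable (fun w => compensatedJump R K F t p w) (noiseLaw μ₀ K) :=
    Integrable.of_bound hm.aestronglyMeasurable _
      (Eventually.of_forall (abs_compensatedJump_le K hR hC hD hp))
  obtain ⟨z, T⟩ := p
  rcases lt_or_ge t T with h | h
  · refine integral_eq_zero_of_ae (Eventually.of_forall fun w => ?_)
    have he : 0 ≤ max w.2.1 0 / R z := div_nonneg (le_max_right _ _) (hR z).le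
    simp only [compensatedJump, Pi.zero_apply]
    rw [if_neg (by linarith), min_eq_left (by linarith), min_eq_left h.le]
    ring
  · set b : ℝ := R z * (t - T) with hb
    have hb0 : 0 ≤ b := mul_nonneg (hR z).le (by linarith)
    set δ : ℝ := ∫ z', F z' ∂(K z) - F z with hδ
    have key : ∀ w : Noise S, compensatedJump R K F t (z, T) w =
        (if max w.2.1 0 ≤ b then F (w.2.2 z) - F z else 0) - δ * min (max w.2.1 0) b := by
      intro w
      have hz := hR z
      have h1 : T + max w.2.1 0 / R z ≤ t ↔ max w.2.1 0 ≤ b := by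
        rw [hb, ← le_sub_iff_add_le', div_le_iff₀ hz, mul_comm]
      simp only [compensatedJump, h1, jumpGenerator, ← hδ, min_eq_right h]
      congr 1
      have h2 : R z * (min t (T + max w.2.1 0 / R z) - T) = min (max w.2.1 0) b := by
        rcases le_total (max w.2.1 0) b with h3 | h3
        · rw [min_eq_left h3, min_eq_right (h1.2 h3)]; field_simp; ring
        · rw [min_eq_right h3, min_eq_left, hb]
          rw [← sub_le_iff_le_add', le_div_iff₀ hz, mul_comm]
          exact h3
      rw [← h2]; ring
    simp only [key] at hint ⊢
    have hF : Integrable (fun u : S → S => F (u z)) (Measure.infinitePi K) :=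
      Integrable.of_bound ((measurable_of_countable F).comp
        (measurable_pi_apply z)).aestronglyMeasurable C (Eventually.of_forall fun u => hC _)
    have hFz : ∫ u, F (u z) ∂(Measure.infinitePi K) = ∫ z', F z' ∂(K z) := by
      rw [← Measure.infinitePi_map_eval K z,
        integral_map (measurable_pi_apply z).aemeasurable
          (measurable_of_countable F).aestronglyMeasurable]
    have hinner : ∀ e : ℝ, ∫ u, ((if max e 0 ≤ b then F (u z) - F z else 0) -
        δ * min (max e 0) b) ∂(Measure.infinitePi K) =
        δ * ((if max e 0 ≤ b then 1 else 0) - min (max e 0) b) := by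
      intro e
      split_ifs
      · have h1 : Integrable (fun u : S → S => F (u z) - F z) (Measure.infinitePi K) :=
          hF.sub (integrable_const _)
        rw [integral_sub h1 (integrable_const _), integral_sub hF (integrable_const _), hFz]
        simp [hδ]; ring
      · simp
    have hsnd : MeasurePreserving Prod.snd (noiseLaw μ₀ K)
      ((ProbabilityTheory.expMeasure 1).prod (Measure.infinitePi K)) := measurePreserving_snd
    have hm' : Measurable fun v : ℝ × (S → S) => (if max v.1 0 ≤ b then F (v.2 z) - F z else 0) -
        δ * min (max v.1 0) b := by
      have hf : Measurable fun v : ℝ × (S → S) => F (v.2 z) - F z :=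
        ((measurable_of_countable F).comp
          ((measurable_pi_apply z).comp measurable_snd)).sub measurable_const
      have hx : Measurable fun v : ℝ × (S → S) => max v.1 0 := measurable_fst.max measurable_const
      exact (Measurable.ite (measurableSet_le hx measurable_const) hf measurable_const).sub
        ((hx.min measurable_const).const_mul δ)
    have e1 := integral_map (μ := noiseLaw μ₀ K) (φ := Prod.snd) measurable_snd.aemeasurable
      (f := fun v : ℝ × (S → S) => (if max v.1 0 ≤ b then F (v.2 z) - F z else 0) -
        δ * min (max v.1 0) b) hm'.aestronglyMeasurable
    rw [hsnd.map_eq] at e1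
    rw [← e1, integral_prod _ ((hsnd.integrable_comp hm'.aestronglyMeasurable).1 hint)]
    simp only [hinner]
    rw [integral_const_mul]
    have : ∫ e, ((if max e 0 ≤ b then 1 else 0) - min (max e 0) b)
        ∂(ProbabilityTheory.expMeasure 1) = 0 := by
      refine (integral_congr_ae ?_).trans (integral_ring_sub_min hb0)
      filter_upwards [ae_pos_expMeasure_one] with e he
      rw [max_eq_left he.le]
    rw [this, mul_zero]

/-- The information available at time `t`: an event belongs to it if, for every `n`, the
noises up to index `n` decide it as long as the jump `n + 1` has not occurred. -/
noncomputable def jumpFiltration (R : S → ℝ) :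
    Filtration ℝ≥0 (MeasurableSpace.pi : MeasurableSpace (ℕ → Noise S)) where
  seq t :=
    { MeasurableSet' := fun A => MeasurableSet A ∧ ∀ n, ∃ B, MeasurableSet B ∧
        ∀ ω, (t : ℝ) < (jumpChain R ω (n + 1)).2 → (ω ∈ A ↔ stopNoise n ω ∈ B)
      measurableSet_empty := ⟨MeasurableSet.empty, fun _ => ⟨∅, MeasurableSet.empty, by simp⟩⟩
      measurableSet_compl := fun A hA => ⟨hA.1.compl, fun n => by
        obtain ⟨B, hB, h⟩ := hA.2 n
        exact ⟨Bᶜ, hB.compl, fun ω hω => not_congr (h ω hω)⟩⟩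
      measurableSet_iUnion := fun A hA => ⟨MeasurableSet.iUnion fun i => (hA i).1, fun n => by
        choose B hB h using fun i => (hA i).2 n
        refine ⟨⋃ i, B i, MeasurableSet.iUnion hB, fun ω hω => ?_⟩
        simp only [Set.mem_iUnion]
        exact exists_congr fun i => h i ω hω⟩ }
  mono' := fun s t hst A hA => ⟨hA.1, fun n => by
    obtain ⟨B, hB, h⟩ := hA.2 n
    exact ⟨B, hB, fun ω hω => h ω (lt_of_le_of_lt (by exact_mod_cast hst) hω)⟩⟩
  le' := fun t A hA => hA.1

omit [Countable S] [MeasurableSingletonClass S] in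
lemma measurable_jumpFiltration {β : Type*} [MeasurableSpace β] {t : ℝ≥0}
    {g : (ℕ → Noise S) → β} (hg : Measurable g) (g' : ℕ → (ℕ → Noise S) → β)
    (hg' : ∀ n, Measurable (g' n))
    (h : ∀ n ω, (t : ℝ) < (jumpChain R ω (n + 1)).2 → g ω = g' n (stopNoise n ω)) :
    Measurable[jumpFiltration R t] g := fun U hU =>
  ⟨hg hU, fun n => ⟨g' n ⁻¹' U, hg' n hU, fun ω hω => by
    simp only [Set.mem_preimage, h n ω hω]⟩⟩

/-- The martingale of `F` along the jump process. -/
noncomputable def jumpMartingale (R : S → ℝ) (K : S → Measure S) (F : S → ℝ) (t : ℝ)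
    (ω : ℕ → Noise S) : ℝ :=
  F (jumpPath R ω t) - ∫ u in (0 : ℝ)..t, jumpGenerator R K F (jumpPath R ω u)

/-- The martingale of `F` stopped at the `n`-th jump, as a sum over the holding times. -/
noncomputable def stoppedMartingale (R : S → ℝ) (K : S → Measure S) (F : S → ℝ) (n : ℕ) (t : ℝ)
    (ω : ℕ → Noise S) : ℝ :=
  F (jumpChain R ω 0).1 +
    ∑ k ∈ Finset.range n, compensatedJump R K F t (jumpChain R ω k) (ω (k + 1))

include hR in
lemma stoppedMartingale_eq (hD : ∀ z, |jumpGenerator R K F z| ≤ D) (n : ℕ) {t : ℝ} (ht : 0 ≤ t)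
    (ω : ℕ → Noise S) : stoppedMartingale R K F n t ω = F (frozenPath R ω n t) -
      ∫ u in (0 : ℝ)..(min t (jumpChain R ω n).2),
        jumpGenerator R K F (frozenPath R ω n u) := by
  set G := jumpGenerator R K F with hG
  have hii : ∀ n a b, IntervalIntegrable (fun u => G (frozenPath R ω n u)) volume a b :=
    fun n => intervalIntegrable_of_abs_le ((measurable_of_countable G).comp
      ((measurable_frozenPath n).comp (measurable_id.prodMk measurable_const))) fun _ => hD _
  induction n with
  | zero => simp [stoppedMartingale, frozenPath, jumpChain, ht]
  | succ n ih =>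
    set T := (jumpChain R ω n).2 with hT
    set T' := (jumpChain R ω (n + 1)).2 with hT'
    have hTT : T ≤ T' := jumpTime_mono hR ω n.le_succ
    have hT'' : T' = T + max (ω (n + 1)).2.1 0 / R (jumpChain R ω n).1 := rfl
    have hstep : stoppedMartingale R K F (n + 1) t ω = stoppedMartingale R K F n t ω +
        compensatedJump R K F t (jumpChain R ω n) (ω (n + 1)) := by
      simp only [stoppedMartingale, Finset.sum_range_succ]; ring
    have hF : F (frozenPath R ω (n + 1) t) = F (frozenPath R ω n t) +
        if T' ≤ t then F (jumpChain R ω (n + 1)).1 - F (jumpChain R ω n).1 else 0 := by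
      simp only [frozenPath, ← hT']
      split_ifs with h
      · rw [frozenPath_of_le ω (hTT.trans h)]; ring
      · ring
    have hI1 : ∫ u in (0 : ℝ)..(min t T'), G (frozenPath R ω (n + 1) u) =
        ∫ u in (0 : ℝ)..(min t T'), G (frozenPath R ω n u) := by
      refine intervalIntegral.integral_congr_ae ?_
      have h0 : ∀ᵐ u : ℝ, u ≠ T' := by simp [ae_iff, measure_singleton]
      have hT0 : 0 ≤ T' := jumpTime_mono hR ω (Nat.zero_le (n + 1))
      filter_upwards [h0] with u hu hmem
      rw [Set.uIoc_of_le (le_min ht hT0)] at hmem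
      have : u < T' := lt_of_le_of_ne (hmem.2.trans (min_le_right _ _)) hu
      simp only [frozenPath, ← hT', if_neg (not_le.2 this)]
    have hI2 : ∫ u in (min t T)..(min t T'), G (frozenPath R ω n u) =
        G (jumpChain R ω n).1 * (min t T' - min t T) := by
      rw [intervalIntegral.integral_congr_ae (g := fun _ => G (jumpChain R ω n).1),
        intervalIntegral.integral_const, smul_eq_mul, mul_comm]
      refine Eventually.of_forall fun u hmem => ?_
      rw [Set.uIoc_of_le (min_le_min le_rfl hTT)] at hmem
      have : T ≤ u := by
        by_contra! hu
        have h1 := hmem.2.trans (min_le_left _ _)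
        exact absurd hmem.1 (not_lt.2 (le_min h1 hu.le))
      rw [frozenPath_of_le ω this]
    rw [hstep, ih, hF, hI1, ← intervalIntegral.integral_add_adjacent_intervals
      (hii n 0 (min t T)) (hii n _ (min t T')), hI2]
    simp only [compensatedJump, ← hT'', ← hG, ← hT]
    have : (ω (n + 1)).2.2 (jumpChain R ω n).1 = (jumpChain R ω (n + 1)).1 := rfl
    rw [this]; ring

include hR in
lemma abs_stoppedMartingale_le (hC : ∀ z, |F z| ≤ C) (hD : ∀ z, |jumpGenerator R K F z| ≤ D)
    (n : ℕ) {t : ℝ} (ht : 0 ≤ t) (ω : ℕ → Noise S) :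
    |stoppedMartingale R K F n t ω| ≤ C + D * t := by
  have hD0 : 0 ≤ D := (abs_nonneg _).trans (hD (ω 0).1)
  rw [stoppedMartingale_eq K hR hD n ht]
  refine (abs_sub _ _).trans (add_le_add (hC _) ?_)
  have h0 : 0 ≤ min t (jumpChain R ω n).2 := le_min ht (jumpTime_mono hR ω (Nat.zero_le n))
  have h1 := intervalIntegral.norm_integral_le_of_norm_le_const (a := 0)
    (b := min t (jumpChain R ω n).2) (C := D)
    (f := fun u => jumpGenerator R K F (frozenPath R ω n u)) fun u _ => hD _
  refine h1.trans ?_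
  rw [sub_zero, abs_of_nonneg h0]
  exact mul_le_mul_of_nonneg_left (min_le_left _ _) hD0

include hR in
lemma stoppedMartingale_of_lt (hD : ∀ z, |jumpGenerator R K F z| ≤ D) {n : ℕ} {t : ℝ}
    (ht : 0 ≤ t) {ω : ℕ → Noise S} (h : t < (jumpChain R ω n).2) :
    stoppedMartingale R K F n t ω = jumpMartingale R K F t ω := by
  have h' : t < (jumpChain R ω (n + 1)).2 := h.trans_le (jumpTime_mono hR ω n.le_succ)
  rw [stoppedMartingale_eq K hR hD n ht, jumpMartingale, jumpPath_eq hR ω h', min_eq_left h.le]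
  congr 1
  refine intervalIntegral.integral_congr fun u hu => ?_
  rw [Set.uIcc_of_le ht] at hu
  simp only [jumpPath_eq hR ω (hu.2.trans_lt h')]

lemma measurable_stoppedMartingale (n : ℕ) (t : ℝ) :
    Measurable (stoppedMartingale R K F n t) := by
  refine ((measurable_of_countable F).comp (measurable_jumpChain 0).fst).add
    (Finset.measurable_sum _ fun k _ => ?_)
  exact (measurable_compensatedJump K t).comp
    ((measurable_jumpChain k).prodMk (measurable_pi_apply (k + 1)))

lemma measurable_jumpMartingale (t : ℝ) : Measurable (jumpMartingale R K F t) := by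
  have hp := measurable_jumpPath (R := R)
  have hG : Measurable (jumpGenerator R K F) := measurable_of_countable _
  refine ((measurable_of_countable F).comp
    (hp.comp (measurable_const.prodMk measurable_id))).sub ?_
  have h : StronglyMeasurable fun q : (ℕ → Noise S) × ℝ =>
      jumpGenerator R K F (jumpPath R q.1 q.2) :=
    (hG.comp (hp.comp measurable_swap)).stronglyMeasurable
  have h1 : ∀ s : Set ℝ, Measurable fun ω : ℕ → Noise S =>
      ∫ u in s, jumpGenerator R K F (jumpPath R ω u) := fun s =>
    (h.integral_prod_right' (ν := volume.restrict s)).measurable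
  simp only [intervalIntegral]
  exact (h1 _).sub (h1 _)

include hR in
lemma measurable_jumpMartingale_filtration (t : ℝ≥0) :
    Measurable[jumpFiltration R t] (jumpMartingale R K F t) := by
  have hp := fun n => measurable_frozenPath (R := R) n
  have hG : Measurable (jumpGenerator R K F) := measurable_of_countable _
  refine measurable_jumpFiltration (measurable_jumpMartingale K t)
    (fun n ω => F (frozenPath R ω n t) - ∫ u in (0 : ℝ)..t,
      jumpGenerator R K F (frozenPath R ω n u)) (fun n => ?_) fun n ω h => ?_
  · refine ((measurable_of_countable F).comp
      ((hp n).comp (measurable_const.prodMk measurable_id))).sub ?_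
    have h : StronglyMeasurable fun q : (ℕ → Noise S) × ℝ =>
        jumpGenerator R K F (frozenPath R q.1 n q.2) :=
      (hG.comp ((hp n).comp measurable_swap)).stronglyMeasurable
    have h1 : ∀ s : Set ℝ, Measurable fun ω : ℕ → Noise S =>
        ∫ u in s, jumpGenerator R K F (frozenPath R ω n u) := fun s =>
      (h.integral_prod_right' (ν := volume.restrict s)).measurable
    simp only [intervalIntegral]
    exact (h1 _).sub (h1 _)
  · simp only [frozenPath_stopNoise ω le_rfl]
    rw [jumpMartingale, jumpPath_eq hR ω h]
    congr 1
    refine intervalIntegral.integral_congr fun u hu => ?_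
    rw [Set.uIcc_of_le (NNReal.coe_nonneg t)] at hu
    simp only [jumpPath_eq hR ω (hu.2.trans_lt h)]

include hR in
lemma measurable_jumpPath_filtration (t : ℝ≥0) :
    Measurable[jumpFiltration R t] fun ω => jumpPath R ω t :=
  measurable_jumpFiltration (measurable_jumpPath.comp (measurable_const.prodMk measurable_id))
    (fun n ω => frozenPath R ω n t)
    (fun n => (measurable_frozenPath n).comp (measurable_const.prodMk measurable_id))
    fun n ω h => by rw [frozenPath_stopNoise ω le_rfl, jumpPath_eq hR ω h]

include hR in
/-- Between `s` and `t`, each holding time contributes zero on average on every event of the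
information at time `s`: after its end nothing changes, and before its end the event is decided
by the noises before it. -/
lemma setIntegral_compensatedJump_eq [∀ z, IsProbabilityMeasure (K z)]
    (hC : ∀ z, |F z| ≤ C)
    (hD : ∀ z, |jumpGenerator R K F z| ≤ D) {s t : ℝ≥0} (hst : s ≤ t) (k : ℕ)
    {A : Set (ℕ → Noise S)} (hA : MeasurableSet[jumpFiltration R s] A) :
    ∫ ω in A, compensatedJump R K F t (jumpChain R ω k) (ω (k + 1)) ∂(jumpLaw μ₀ K) =
      ∫ ω in A, compensatedJump R K F s (jumpChain R ω k) (ω (k + 1)) ∂(jumpLaw μ₀ K) := by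
  set inc : ℝ → (ℕ → Noise S) → ℝ :=
    fun t ω => compensatedJump R K F t (jumpChain R ω k) (ω (k + 1)) with hinc
  have hT0 : ∀ ω, 0 ≤ (jumpChain R ω k).2 := fun ω => jumpTime_mono hR ω (Nat.zero_le k)
  have hm : ∀ t, Measurable (inc t) := fun t => (measurable_compensatedJump K t).comp
    ((measurable_jumpChain k).prodMk (measurable_pi_apply (k + 1)))
  have hi : ∀ t, Integrable (inc t) (jumpLaw μ₀ K) := fun t =>
    Integrable.of_bound (hm t).aestronglyMeasurable _
      (Eventually.of_forall fun ω => abs_compensatedJump_le K hR hC hD (hT0 ω) _)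
  obtain ⟨hA0, hA1⟩ := hA
  obtain ⟨B, hB, hAB⟩ := hA1 k
  have hzero : ∀ t, ∫ ω in stopNoise k ⁻¹' B, inc t ω ∂(jumpLaw μ₀ K) = 0 := fun t => by
    have h := setIntegral_next_eq_zero μ₀ K (n := k)
      (g := fun ω w => compensatedJump R K F t (jumpChain R ω k) w)
      ((measurable_compensatedJump K t).comp
        (((measurable_jumpChain k).comp measurable_fst).prodMk measurable_snd))
      (fun ω w => abs_compensatedJump_le K hR hC hD (hT0 ω) w)
      (fun ω => integral_compensatedJump μ₀ K hR hC hD t (hT0 ω)) hB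
    simpa only [jumpChain_stopNoise _ le_rfl] using h
  have hB' : MeasurableSet (stopNoise k ⁻¹' B) := measurable_stopNoise k hB
  have hset : A.indicator (fun ω => inc t ω - inc s ω) =
      (stopNoise k ⁻¹' B).indicator fun ω => inc t ω - inc s ω := by
    ext ω
    by_cases h : (s : ℝ) < (jumpChain R ω (k + 1)).2
    · by_cases h' : ω ∈ A
      · have : ω ∈ stopNoise k ⁻¹' B := (hAB ω h).1 h'
        rw [Set.indicator_of_mem h', Set.indicator_of_mem this]
      · have : ω ∉ stopNoise k ⁻¹' B := fun hh => h' ((hAB ω h).2 hh)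
        rw [Set.indicator_of_notMem h', Set.indicator_of_notMem this]
    · have hs : (jumpChain R ω (k + 1)).2 ≤ s := not_lt.1 h
      have ht : (jumpChain R ω (k + 1)).2 ≤ t := hs.trans (by exact_mod_cast hst)
      have hk := jumpTime_mono hR ω k.le_succ
      have hval : ∀ t : ℝ, (jumpChain R ω (k + 1)).2 ≤ t → inc t ω =
          F (jumpChain R ω (k + 1)).1 - F (jumpChain R ω k).1 - jumpGenerator R K F
            (jumpChain R ω k).1 * ((jumpChain R ω (k + 1)).2 - (jumpChain R ω k).2) := by
        intro t ht
        have hk' : (jumpChain R ω k).2 ≤ t := hk.trans ht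
        have h1 : (jumpChain R ω k).2 + max (ω (k + 1)).2.1 0 / R (jumpChain R ω k).1 =
          (jumpChain R ω (k + 1)).2 := rfl
        simp only [hinc, compensatedJump, h1, if_pos ht, min_eq_right ht, min_eq_right hk']
        rfl
      have : inc t ω - inc s ω = 0 := by rw [hval t ht, hval s hs, sub_self]
      simp [Set.indicator, this]
  have h1 : ∫ ω in A, (inc t ω - inc s ω) ∂(jumpLaw μ₀ K) = 0 := by
    rw [← integral_indicator hA0, hset, integral_indicator hB',
      integral_sub (hi t).integrableOn (hi s).integrableOn, hzero, hzero, sub_self]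
  rw [integral_sub (hi t).integrableOn (hi s).integrableOn] at h1
  exact sub_eq_zero.1 h1

theorem martingale_jumpMartingale [∀ z, IsProbabilityMeasure (K z)]
    (hR : ∀ z, 0 < R z) (hC : ∀ z, |F z| ≤ C)
    (hD : ∀ z, |jumpGenerator R K F z| ≤ D)
    (hT : ∀ᵐ ω ∂(jumpLaw μ₀ K), ∀ t, ∃ n, t < (jumpChain R ω (n + 1)).2) :
    Martingale (fun (t : ℝ≥0) => jumpMartingale R K F t) (jumpFiltration R) (jumpLaw μ₀ K) := by
  have hlim : ∀ t : ℝ≥0, ∀ᵐ ω ∂(jumpLaw μ₀ K), Tendsto (fun n => stoppedMartingale R K F n t ω)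
      atTop (𝓝 (jumpMartingale R K F t ω)) := fun t => by
    filter_upwards [hT] with ω hω
    obtain ⟨n, hn⟩ := hω t
    refine tendsto_const_nhds.congr' ?_
    filter_upwards [eventually_ge_atTop (n + 1)] with m hm
    exact (stoppedMartingale_of_lt K hR hD t.2 (hn.trans_le (jumpTime_mono hR ω hm))).symm
  have hint : ∀ t : ℝ≥0, Integrable (jumpMartingale R K F t) (jumpLaw μ₀ K) := fun t =>
    Integrable.of_bound (measurable_jumpMartingale K t).aestronglyMeasurable (C + D * t) (by
      filter_upwards [hlim t] with ω hω
      exact le_of_tendsto hω.norm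
        (Eventually.of_forall fun n => abs_stoppedMartingale_le K hR hC hD n t.2 ω))
  refine ⟨fun t => (measurable_jumpMartingale_filtration K hR t).stronglyMeasurable,
    fun s t hst => ?_⟩
  symm
  refine ae_eq_condExp_of_forall_setIntegral_eq ((jumpFiltration R).le s) (hint t)
    (fun _ _ _ => (hint s).integrableOn) (fun A hA _ => ?_)
    (measurable_jumpMartingale_filtration K hR s).aestronglyMeasurable
  have hsets : ∀ t : ℝ≥0, Tendsto (fun n => ∫ ω in A, stoppedMartingale R K F n t ω
      ∂(jumpLaw μ₀ K)) atTop (𝓝 (∫ ω in A, jumpMartingale R K F t ω ∂(jumpLaw μ₀ K))) := fun t =>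
    tendsto_integral_of_dominated_convergence (fun _ => C + D * t)
      (fun n => (measurable_stoppedMartingale K n t).aestronglyMeasurable)
      (integrable_const _)
      (fun n => Eventually.of_forall fun ω => abs_stoppedMartingale_le K hR hC hD n t.2 ω)
      (ae_restrict_of_ae (hlim t))
  refine tendsto_nhds_unique (hsets s) ((hsets t).congr fun n => ?_)
  have hi : ∀ (t : ℝ≥0) (k : ℕ), Integrable (fun ω => compensatedJump R K F t (jumpChain R ω k)
      (ω (k + 1))) ((jumpLaw μ₀ K).restrict A) := fun t k =>
    Integrable.of_bound ((measurable_compensatedJump K t).comp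
      ((measurable_jumpChain k).prodMk (measurable_pi_apply (k + 1)))).aestronglyMeasurable _
      (Eventually.of_forall fun ω => abs_compensatedJump_le K hR hC hD
        (jumpTime_mono hR ω (Nat.zero_le k)) _)
  have h0 : Integrable (fun ω => F (jumpChain R ω 0).1) ((jumpLaw μ₀ K).restrict A) :=
    Integrable.of_bound ((measurable_of_countable F).comp
      (measurable_jumpChain 0).fst).aestronglyMeasurable C (Eventually.of_forall fun ω => hC _)
  simp only [stoppedMartingale]
  rw [integral_add h0 (integrable_finsetSum _ fun k _ => hi t k),
    integral_add h0 (integrable_finsetSum _ fun k _ => hi s k),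
    integral_finsetSum _ fun k _ => hi t k, integral_finsetSum _ fun k _ => hi s k]
  congr 1
  exact Finset.sum_congr rfl fun k _ => setIntegral_compensatedJump_eq μ₀ K hR hC hD hst k hA

end Martingale

/-- A jump process with holding rates `R` and jump laws `K` exists, if a jump increases the rates
at most by a constant: its paths are right-continuous step functions with left limits, they
respect every preorder that the jumps respect, and they solve the martingale problem. -/
theorem exists_jumpProcess {S : Type} [Countable S] [MeasurableSpace S]
    [MeasurableSingletonClass S] (μ₀ : Measure S) [IsProbabilityMeasure μ₀]
    (K : S → Measure S) [∀ z, IsProbabilityMeasure (K z)] {R : S → ℝ} (hR : ∀ z, 0 < R z)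
    {c : ℝ} (hc : 0 ≤ c) (hK : ∀ z, ∀ᵐ z' ∂(K z), R z' ≤ R z + c) :
    ∃ (Ω : Type) (mΩ : MeasurableSpace Ω) (P : Measure Ω) (_ : IsProbabilityMeasure P)
      (Z : ℝ≥0 → Ω → S) (ℱ : Filtration ℝ≥0 mΩ),
      (∀ t, Measurable[ℱ t] (Z t)) ∧
      (∀ᵐ ω ∂P, ∀ t, ∀ᶠ s in 𝓝[>] t, Z s ω = Z t ω) ∧
      (∀ᵐ ω ∂P, ∀ t, 0 < t → ∃ z, ∀ᶠ s in 𝓝[<] t, Z s ω = z) ∧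
      P.map (Z 0) = μ₀ ∧
      (∀ ρ : S → S → Prop, (∀ z, ρ z z) → (∀ a b c, ρ a b → ρ b c → ρ a c) →
        (∀ z, ∀ᵐ z' ∂(K z), ρ z z') → ∀ᵐ ω ∂P, ∀ s t, s ≤ t → ρ (Z s ω) (Z t ω)) ∧
      ∀ (F : S → ℝ) (C D : ℝ), (∀ z, |F z| ≤ C) → (∀ z, |jumpGenerator R K F z| ≤ D) →
        Martingale (fun (t : ℝ≥0) ω => F (Z t ω) -
          ∫ s in (0 : ℝ)..t, jumpGenerator R K F (Z s.toNNReal ω)) ℱ P := by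
  have hT := ae_exists_lt_jumpTime μ₀ K hR hc hK
  refine ⟨ℕ → Noise S, inferInstance, jumpLaw μ₀ K, inferInstance, fun t ω => jumpPath R ω t,
    jumpFiltration R, measurable_jumpPath_filtration hR, ?_, ?_, ?_, ?_, ?_⟩
  · filter_upwards [hT] with ω hω t
    obtain ⟨n, hn⟩ := hω t
    have h1 : ∀ᶠ s : ℝ≥0 in 𝓝[>] t, (s : ℝ) < (jumpChain R ω (n + 1)).2 :=
      nhdsWithin_le_nhds ((NNReal.continuous_coe.tendsto t).eventually_lt_const hn)
    filter_upwards [h1, frozenPath_rightCont ω n t] with s hs hs'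
    rw [jumpPath_eq hR ω hs, jumpPath_eq hR ω hn, hs']
  · filter_upwards [hT] with ω hω t _
    obtain ⟨n, hn⟩ := hω t
    obtain ⟨z, hz⟩ := frozenPath_leftLim (R := R) ω n t
    refine ⟨z, ?_⟩
    filter_upwards [hz, self_mem_nhdsWithin] with s hs hst
    have hst : (s : ℝ) < t := hst
    rw [jumpPath_eq hR ω (hst.trans hn), hs]
  · have h0 : (fun ω => jumpPath R ω ((0 : ℝ≥0) : ℝ)) =ᵐ[jumpLaw μ₀ K] fun ω => (ω 0).1 := by
      filter_upwards [ae_forall_exp_pos μ₀ K] with ω hω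
      have : (((0 : ℝ≥0) : ℝ)) < (jumpChain R ω (0 + 1)).2 := by
        simp only [jumpChain, NNReal.coe_zero, zero_add]
        exact div_pos (lt_max_of_lt_left (hω 1)) (hR _)
      rw [jumpPath_eq hR ω this]; rfl
    have h1 : (fun ω : ℕ → Noise S => (ω 0).1) = Prod.fst ∘ fun ω => ω 0 := rfl
    rw [Measure.map_congr h0, h1, ← Measure.map_map measurable_fst (measurable_pi_apply 0),
      map_jumpLaw_eval, map_noiseLaw_init]
  · intro ρ hrefl htrans hρ
    filter_upwards [hT, ae_forall_jump μ₀ K hρ] with ω h1 h2 s t hst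
    exact jumpPath_rel hR hrefl htrans (fun n z => h2 (n + 1) z) h1 (by exact_mod_cast hst)
  · intro F C D hC hD
    have h := martingale_jumpMartingale μ₀ K hR hC hD hT
    convert h using 3 with t ω
    rw [jumpMartingale]
    congr 1
    refine intervalIntegral.integral_congr fun u hu => ?_
    rw [Set.uIcc_of_le (NNReal.coe_nonneg t)] at hu
    simp only [Real.coe_toNNReal u hu.1]

/-! ### Truncated loads and the ordering of the tasks -/

section Loads

variable {N : ℕ}

/-- The number of tasks at the `k` lowest levels, `Q_1 + ... + Q_k`. -/
def truncLoad (k : ℕ) (x : Config N) : ℕ := ∑ c, min (x c) k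

/-- The number of tasks at pools with at most `k` tasks. -/
def tasksUpTo (k : ℕ) (x : Config N) : ℕ := ∑ c, if x c ≤ k then x c else 0

lemma truncLoad_succ (k : ℕ) (x : Config N) :
    truncLoad (k + 1) x = truncLoad k x + occupancy (k + 1) x := by
  rw [truncLoad, truncLoad, occupancy, Finset.card_filter, ← Finset.sum_add_distrib]
  refine Finset.sum_congr rfl fun c _ => ?_
  split_ifs <;> omega

lemma tasksUpTo_add (k : ℕ) (x : Config N) :
    tasksUpTo k x + k * truncLoad (k + 1) x = (k + 1) * truncLoad k x := by
  rw [truncLoad, truncLoad, tasksUpTo, Finset.mul_sum, Finset.mul_sum, ← Finset.sum_add_distrib]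
  refine Finset.sum_congr rfl fun c _ => ?_
  split_ifs with h
  · rw [min_eq_left h, min_eq_left (by omega)]; ring
  · rw [min_eq_right (by omega), min_eq_right (by omega)]; ring

/-- The pools of all active tasks, one entry for every task, in increasing order of the numbers of
active tasks at the pools. -/
noncomputable def taskList (x : Config N) : List (Fin N) :=
  List.insertionSort (fun a b => x a ≤ x b) (∑ c, Multiset.replicate (x c) c).toList

/-- The state after the completion of the `j`-th task of `taskList` (if there is one). -/
noncomputable def depart (x : Config N) (j : ℕ) : Config N :=
  ((taskList x)[j]?).elim x (complete x)

lemma taskList_coe (x : Config N) :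
    (taskList x : Multiset (Fin N)) = ∑ c, Multiset.replicate (x c) c := by
  rw [taskList, Multiset.coe_eq_coe.2 (List.perm_insertionSort _ _), Multiset.coe_toList]

lemma sum_map_taskList {M : Type*} [AddCommMonoid M] (x : Config N) (g : Fin N → M) :
    ((taskList x).map g).sum = ∑ c, x c • g c := by
  rw [← Multiset.sum_coe, ← Multiset.map_coe, taskList_coe]
  induction (Finset.univ : Finset (Fin N)) using Finset.cons_induction with
  | empty => simp
  | cons c s hc ih =>
    rw [Finset.sum_cons, Multiset.map_add, Multiset.sum_add, ih, Finset.sum_cons]; simp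

lemma length_taskList (x : Config N) : (taskList x).length = ∑ c, x c := by
  simpa [List.map_const'] using sum_map_taskList x fun _ => (1 : ℕ)

lemma pos_of_mem_taskList {x : Config N} {c : Fin N} (h : c ∈ taskList x) : 0 < x c := by
  rw [← Multiset.mem_coe, taskList_coe, Multiset.mem_sum] at h
  obtain ⟨c', _, h⟩ := h
  obtain ⟨h1, rfl⟩ := Multiset.mem_replicate.1 h
  omega

lemma getElem_le_iff_lt_countP {α : Type*} {f : α → ℕ} (k : ℕ) {L : List α}
    (h : L.Pairwise fun a b => f a ≤ f b) {j : ℕ} (hj : j < L.length) :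
    f L[j] ≤ k ↔ j < L.countP fun a => f a ≤ k := by
  induction L generalizing j with
  | nil => simp at hj
  | cons a L ih =>
    obtain ⟨h1, h2⟩ := List.pairwise_cons.1 h
    by_cases ha : f a ≤ k
    · cases j with
      | zero => simp [ha]
      | succ j => simpa [ha] using ih h2 (by simpa using hj)
    · have h0 : L.countP (fun a => f a ≤ k) = 0 :=
        List.countP_eq_zero.2 fun b hb => by have := h1 b hb; simp; omega
      cases j with
      | zero => simp [ha, h0]
      | succ j =>
        have := h1 _ (List.getElem_mem (by simpa using hj : j < L.length))
        simp only [List.getElem_cons_succ, List.countP_cons, h0, ha]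
        simp; omega

/-- The `j`-th task leaves one of the `k` lowest levels if and only if it is one of the tasks at
pools with at most `k` tasks. -/
lemma truncLoad_depart (k : ℕ) (x : Config N) (j : ℕ) :
    truncLoad k (depart x j) + (if j < tasksUpTo k x then 1 else 0) = truncLoad k x := by
  have hle : tasksUpTo k x ≤ ∑ c, x c :=
    Finset.sum_le_sum fun c _ => by split_ifs <;> omega
  rcases lt_or_ge j (taskList x).length with hj | hj
  · have hsort : (taskList x).Pairwise fun a b => x a ≤ x b := by
      have : Std.Total fun a b : Fin N => x a ≤ x b := ⟨fun a b => le_total _ _⟩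
      have : IsTrans (Fin N) fun a b => x a ≤ x b := ⟨fun a b c => le_trans⟩
      exact List.pairwise_insertionSort _ _
    have hcount : (taskList x).countP (fun c => x c ≤ k) = tasksUpTo k x := by
      have := sum_map_taskList x fun c => if x c ≤ k then (1 : ℕ) else 0
      have h2 : ∀ L : List (Fin N), (L.map fun c => if x c ≤ k then 1 else 0).sum =
          L.countP fun c => x c ≤ k := fun L => by
        induction L with
        | nil => rfl
        | cons a L ih => simp only [List.map_cons, List.sum_cons, List.countP_cons, ih]; simp; omega
      rw [← h2, this, tasksUpTo]
      simp
    have hiff := getElem_le_iff_lt_countP (f := x) k hsort hj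
    rw [hcount] at hiff
    rw [depart, List.getElem?_eq_getElem hj, Option.elim_some]
    set c := (taskList x)[j] with hc
    have hpos : 0 < x c := pos_of_mem_taskList (List.getElem_mem hj)
    simp only [← hiff]
    rw [truncLoad, truncLoad, ← Finset.add_sum_erase _ _ (Finset.mem_univ c),
      ← Finset.add_sum_erase _ (fun c => min (x c) k) (Finset.mem_univ c)]
    have : ∑ c' ∈ Finset.univ.erase c, min (complete x c c') k =
        ∑ c' ∈ Finset.univ.erase c, min (x c') k :=
      Finset.sum_congr rfl fun c' hc' => by
        rw [complete, Function.update_of_ne (Finset.ne_of_mem_erase hc')]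
    rw [this, complete, Function.update_self]
    split_ifs <;> omega
  · rw [depart, List.getElem?_eq_none hj, Option.elim_none, if_neg]
    · rfl
    · rw [length_taskList] at hj; omega

lemma complete_le (x : Config N) (c p : Fin N) : complete x c p ≤ x p := by
  rw [complete]
  by_cases h : p = c
  · subst h; simp
  · rw [Function.update_of_ne h]

lemma depart_le (x : Config N) (j : ℕ) (p : Fin N) : depart x j p ≤ x p := by
  rw [depart]
  cases (taskList x)[j]? with
  | none => exact le_rfl
  | some c => exact complete_le x c p

lemma addTask_le {B : ℕ∞} {x : Config N} (h : ∀ c, (x c : ℕ∞) ≤ B) (c p : Fin N) :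
    (addTask B x c p : ℕ∞) ≤ B := by
  rw [addTask]
  split_ifs with h1
  · by_cases hp : p = c
    · subst hp
      rw [Function.update_self]
      exact_mod_cast Order.add_one_le_of_lt h1
    · rw [Function.update_of_ne hp]; exact h p
  · exact h p

open Classical in
lemma truncLoad_addTask (B : ℕ∞) (k : ℕ) (x : Config N) (c : Fin N) :
    truncLoad k (addTask B x c) =
      truncLoad k x + if (x c : ℕ∞) < B ∧ x c < k then 1 else 0 := by
  by_cases h : (x c : ℕ∞) < B
  · have ha : addTask B x c = Function.update x c (x c + 1) := if_pos h
    simp only [ha, h, true_and]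
    rw [truncLoad, truncLoad, ← Finset.add_sum_erase _ _ (Finset.mem_univ c),
      ← Finset.add_sum_erase _ (fun c => min (x c) k) (Finset.mem_univ c)]
    have : ∑ c' ∈ Finset.univ.erase c, min (Function.update x c (x c + 1) c') k =
        ∑ c' ∈ Finset.univ.erase c, min (x c') k :=
      Finset.sum_congr rfl fun c' hc' => by
        rw [Function.update_of_ne (Finset.ne_of_mem_erase hc')]
    rw [this, Function.update_self]
    split_ifs <;> omega
  · simp [addTask, h]

lemma sum_addTask_le (B : ℕ∞) (x : Config N) (c : Fin N) :
    ∑ p, addTask B x c p ≤ ∑ p, x p + 1 := by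
  classical
  rw [addTask]
  split_ifs
  · rw [Finset.sum_update_of_mem (Finset.mem_univ c), ← Finset.add_sum_erase _ x
      (Finset.mem_univ c), Finset.sdiff_singleton_eq_erase]
    omega
  · omega

lemma sum_complete_add_one (x : Config N) (c : Fin N) :
    ∑ p, x p ≤ ∑ p, complete x c p + 1 := by
  rw [complete, Finset.sum_update_of_mem (Finset.mem_univ c), ← Finset.add_sum_erase _ x
    (Finset.mem_univ c), Finset.sdiff_singleton_eq_erase]
  omega

end Loads

/-! ### The invariant of the coupling -/

section Invariant

variable {N : ℕ}

/-- A state of the coupling: the states of the two systems, and the number of arrivals so far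
that the second system has sent to a pool with too many shorter ones. -/
abbrev CoupledState (N : ℕ) : Type := Config N × Config N × ℕ

/-- The number of pools with fewer active tasks than the pool `c`. -/
def numShorter (x : Config N) (c : Fin N) : ℕ := (Finset.univ.filter fun p => x p < x c).card

/-- The two systems are sandwiched: on the `k` lowest levels together, the second one holds at
most as many tasks as the first one, and lacks at most `n` tasks per level, apart from those
accounted for by the counter. -/
def Sandwiched (B : ℕ∞) (n : ℕ) (z : CoupledState N) : Prop :=
  (∀ c, (z.1 c : ℕ∞) ≤ B) ∧ (∀ c, (z.2.1 c : ℕ∞) ≤ B) ∧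
    ∀ k, truncLoad k z.2.1 ≤ truncLoad k z.1 ∧
      truncLoad k z.1 ≤ truncLoad k z.2.1 + k * n + z.2.2

lemma Sandwiched.abs_sub_le {B : ℕ∞} {n : ℕ} {z : CoupledState N} (h : Sandwiched B n z) {i : ℕ}
    (hi : 1 ≤ i) : |(occupancy i z.1 : ℝ) - occupancy i z.2.1| ≤ i * n + z.2.2 := by
  obtain ⟨k, rfl⟩ : ∃ k, i = k + 1 := ⟨i - 1, by omega⟩
  obtain ⟨h1, h2⟩ := h.2.2 k
  obtain ⟨h3, h4⟩ := h.2.2 (k + 1)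
  rw [truncLoad_succ, truncLoad_succ] at h3 h4
  have hkn : k * n ≤ (k + 1) * n := Nat.mul_le_mul_right _ (Nat.le_succ k)
  have h5 : occupancy (k + 1) z.1 ≤ occupancy (k + 1) z.2.1 + ((k + 1) * n + z.2.2) := by omega
  have h6 : occupancy (k + 1) z.2.1 ≤ occupancy (k + 1) z.1 + ((k + 1) * n + z.2.2) := by omega
  have h5' : (occupancy (k + 1) z.1 : ℝ) ≤
    occupancy (k + 1) z.2.1 + ((k + 1 : ℕ) * n + z.2.2) := by exact_mod_cast h5
  have h6' : (occupancy (k + 1) z.2.1 : ℝ) ≤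
    occupancy (k + 1) z.1 + ((k + 1 : ℕ) * n + z.2.2) := by exact_mod_cast h6
  rw [abs_le]; constructor <;> linarith

/-- Departures of the `j`-th tasks in both systems preserve the sandwich. When a bound for the
level `k` is attained, then the bound for `k + 1` compares the numbers of tasks at pools with at
most `k` tasks, so that the task that leaves is among them in the system that must lose one. -/
lemma Sandwiched.depart {B : ℕ∞} {n : ℕ} {z : CoupledState N} (h : Sandwiched B n z) (j : ℕ) :
    Sandwiched B n (depart z.1 j, depart z.2.1 j, z.2.2) := by
  obtain ⟨hx, hy, h⟩ := h
  refine ⟨fun c => le_trans (by exact_mod_cast depart_le _ _ _) (hx c),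
    fun c => le_trans (by exact_mod_cast depart_le _ _ _) (hy c), fun k => ?_⟩
  obtain ⟨h1, h2⟩ := h k
  obtain ⟨h3, h4⟩ := h (k + 1)
  have hdx := truncLoad_depart k z.1 j
  have hdy := truncLoad_depart k z.2.1 j
  have hax := tasksUpTo_add k z.1
  have hay := tasksUpTo_add k z.2.1
  have h3' := Nat.mul_le_mul_left k h3
  have h4' := Nat.mul_le_mul_left k h4
  dsimp only at *
  constructor
  · by_cases hj : j < tasksUpTo k z.1 ∧ ¬ j < tasksUpTo k z.2.1
    · rw [if_pos hj.1] at hdx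
      rw [if_neg hj.2] at hdy
      have hne : truncLoad k z.2.1 ≠ truncLoad k z.1 := fun he => by
        rw [he] at hay; omega
      omega
    · split_ifs at hdx hdy <;> omega
  · by_cases hj : j < tasksUpTo k z.2.1 ∧ ¬ j < tasksUpTo k z.1
    · rw [if_pos hj.1] at hdy
      rw [if_neg hj.2] at hdx
      have hne : truncLoad k z.1 ≠ truncLoad k z.2.1 + k * n + z.2.2 := fun he => by
        rw [he] at hax
        have : tasksUpTo k z.2.1 ≤ tasksUpTo k z.1 := by nlinarith
        omega
      omega
    · split_ifs at hdx hdy <;> omega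

/-- An arrival that goes to a shortest pool in the first system preserves the sandwich, if it is
counted when it goes to a pool with more than `n` shorter pools in the second system. -/
lemma Sandwiched.addTask {B : ℕ∞} {n : ℕ} {z : CoupledState N} (h : Sandwiched B n z)
    {c c' : Fin N} (hc : ∀ p, z.1 c ≤ z.1 p) :
    Sandwiched B n (LoadBalancing.addTask B z.1 c, LoadBalancing.addTask B z.2.1 c',
      z.2.2 + if n < numShorter z.2.1 c' then 1 else 0) := by
  classical
  obtain ⟨x, y, δ⟩ := z
  obtain ⟨hx, hy, h⟩ := h
  dsimp only at *
  have hx' := addTask_le hx c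
  have hy' := addTask_le hy c'
  refine ⟨hx', hy', fun k => ?_⟩
  obtain ⟨h1, h2⟩ := h k
  have hax := truncLoad_addTask B k x c
  have hay := truncLoad_addTask B k y c'
  dsimp only at *
  constructor
  · by_cases hinc : (x c : ℕ∞) < B ∧ x c < k
    · rw [if_pos hinc] at hax
      rw [hax, hay]
      split_ifs <;> omega
    · rw [if_neg hinc] at hax
      rw [hax, add_zero]
      refine Finset.sum_le_sum fun p _ => ?_
      by_cases hk : x c < k
      · -- all pools of the first system are full
        have hB : B ≤ x c := not_lt.1 fun hlt => hinc ⟨hlt, hk⟩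
        have : LoadBalancing.addTask B y c' p ≤ x c := by
          exact_mod_cast (hy' p).trans hB
        exact min_le_min (this.trans (hc p)) le_rfl
      · have := hc p
        omega
  · by_cases hbad : n < numShorter y c'
    · rw [if_pos hbad, hax, hay]
      split_ifs <;> omega
    · rw [if_neg hbad]
      by_cases hinc : (y c' : ℕ∞) < B ∧ y c' < k
      · rw [if_pos hinc] at hay
        rw [hax, hay]
        split_ifs <;> omega
      · rw [if_neg hinc] at hay
        rw [hay, add_zero, add_zero]
        have hpt : ∀ p, min (LoadBalancing.addTask B x c p) k ≤
            min (y p) k + if y p < y c' then k else 0 := fun p => by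
          split_ifs with hp
          · omega
          · by_cases hk : y c' < k
            · have hB : B ≤ y c' := not_lt.1 fun hlt => hinc ⟨hlt, hk⟩
              have : LoadBalancing.addTask B x c p ≤ y c' := by
                exact_mod_cast (hx' p).trans hB
              omega
            · omega
        have hsum : truncLoad k (LoadBalancing.addTask B x c) ≤
            truncLoad k y + k * numShorter y c' := by
          refine (Finset.sum_le_sum fun p _ => hpt p).trans (le_of_eq ?_)
          rw [Finset.sum_add_distrib, truncLoad, numShorter, ← Finset.sum_filter,
            Finset.sum_const, smul_eq_mul, mul_comm k]
        have := Nat.mul_le_mul_left k (not_lt.1 hbad)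
        omega

end Invariant

/-! ### The coupling of two schemes -/

section Coupling

variable {N : ℕ} (lam : ℝ≥0) (B : ℕ∞) (π π' : Scheme N) (n : ℕ)

/-- The state after an arrival that is sent to the pools `c` and `c'` in the two systems. -/
noncomputable def coupledArrival (z : CoupledState N) (c c' : Fin N) : CoupledState N :=
  (addTask B z.1 c, addTask B z.2.1 c', z.2.2 + if n < numShorter z.2.1 c' then 1 else 0)

/-- The state after the departures of the `j`-th tasks in both systems. -/
noncomputable def coupledDeparture (z : CoupledState N) (j : ℕ) : CoupledState N :=
  (depart z.1 j, depart z.2.1 j, z.2.2)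

/-- The total number of tasks in the two systems. -/
def totalTasks (z : CoupledState N) : ℕ := ∑ c, z.1 c + ∑ c, z.2.1 c

/-- The holding rate of the coupling. There are more departure clocks than tasks, those without
a task cause no change; this keeps the rate positive. -/
noncomputable def coupledRate (z : CoupledState N) : ℝ := lam + (totalTasks z + 1 : ℕ)

/-- The jump law of the coupling: arrivals occur simultaneously at rate `lam`, and the `j`-th
tasks leave simultaneously at rate one. -/
noncomputable def coupledKernel (z : CoupledState N) : Measure (CoupledState N) :=
  ENNReal.ofReal (coupledRate lam z)⁻¹ •
    (∑ c, ∑ c', ((lam : ℝ≥0∞) * (π z.1 c * π' z.2.1 c')) •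
        Measure.dirac (coupledArrival B n z c c') +
      ∑ j ∈ Finset.range (totalTasks z + 1), Measure.dirac (coupledDeparture z j))

lemma coupledRate_pos (z : CoupledState N) : 0 < coupledRate lam z := by
  rw [coupledRate]; positivity

lemma sum_toReal_scheme (π : Scheme N) (x : Config N) : ∑ c, (π x c).toReal = 1 := by
  rw [← ENNReal.toReal_sum fun c _ => (π x).apply_ne_top c, ← tsum_fintype (L := .unconditional _),
    (π x).tsum_coe, ENNReal.toReal_one]

lemma sum_scheme (π : Scheme N) (x : Config N) : ∑ c, π x c = 1 := by
  rw [← tsum_fintype (L := .unconditional _), (π x).tsum_coe]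

instance (z : CoupledState N) : IsProbabilityMeasure (coupledKernel lam B π π' n z) := ⟨by
  have h1 : ∑ c, ∑ c', (lam : ℝ≥0∞) * (π z.1 c * π' z.2.1 c') = lam := by
    simp_rw [← Finset.mul_sum, sum_scheme, mul_one, sum_scheme, mul_one]
  have h2 : (lam : ℝ≥0∞) + (totalTasks z + 1 : ℕ) = ENNReal.ofReal (coupledRate lam z) := by
    rw [coupledRate, ENNReal.ofReal_add (NNReal.coe_nonneg lam) (Nat.cast_nonneg _), ENNReal.ofReal_natCast]
    simp
  simp only [coupledKernel, Measure.smul_apply, Measure.add_apply, Measure.finsetSum_apply,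
    measure_univ, smul_eq_mul, mul_one, h1, Finset.sum_const, Finset.card_range, nsmul_eq_mul]
  rw [h2, ← ENNReal.ofReal_mul (inv_nonneg.2 (coupledRate_pos lam z).le),
    inv_mul_cancel₀ (coupledRate_pos lam z).ne', ENNReal.ofReal_one]⟩

lemma ae_coupledKernel {p : CoupledState N → Prop} {z : CoupledState N}
    (ha : ∀ c c', π z.1 c ≠ 0 → p (coupledArrival B n z c c'))
    (hd : ∀ j, p (coupledDeparture z j)) : ∀ᵐ z' ∂(coupledKernel lam B π π' n z), p z' := by
  refine Measure.ae_smul_measure ?_ _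
  rw [ae_add_measure_iff, ae_finsetSum_measure_iff, ae_finsetSum_measure_iff]
  refine ⟨fun c _ => ?_, fun j _ => by simpa [ae_dirac_eq] using hd j⟩
  rw [ae_finsetSum_measure_iff]
  intro c' _
  by_cases hc : π z.1 c = 0
  · simp [hc]
  · exact Measure.ae_smul_measure (by simpa [ae_dirac_eq] using ha c c' hc) _

/-- The generator of the coupling. -/
lemma jumpGenerator_coupled (F : CoupledState N → ℝ) (z : CoupledState N) :
    jumpGenerator (coupledRate lam) (coupledKernel lam B π π' n) F z =
      lam * ∑ c, ∑ c', (π z.1 c).toReal * (π' z.2.1 c').toReal *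
          (F (coupledArrival B n z c c') - F z) +
        ∑ j ∈ Finset.range (totalTasks z + 1), (F (coupledDeparture z j) - F z) := by
  have hR := coupledRate_pos lam z
  have hi : ∀ z', Integrable F (Measure.dirac z') := fun z' => integrable_dirac (by simp)
  have hne : ∀ c c', (lam : ℝ≥0∞) * (π z.1 c * π' z.2.1 c') ≠ ∞ := fun c c' =>
    ENNReal.mul_ne_top ENNReal.coe_ne_top
      (ENNReal.mul_ne_top ((π _).apply_ne_top c) ((π' _).apply_ne_top c'))
  have hi' : ∀ c c', Integrable F (((lam : ℝ≥0∞) * (π z.1 c * π' z.2.1 c')) •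
      Measure.dirac (coupledArrival B n z c c')) := fun c c' => (hi _).smul_measure (hne c c')
  have hint : ∫ z', F z' ∂(coupledKernel lam B π π' n z) = (coupledRate lam z)⁻¹ *
      (∑ c, ∑ c', lam * ((π z.1 c).toReal * (π' z.2.1 c').toReal) *
          F (coupledArrival B n z c c') +
        ∑ j ∈ Finset.range (totalTasks z + 1), F (coupledDeparture z j)) := by
    rw [coupledKernel, integral_smul_measure, integral_add_measure,
      integral_finsetSum_measure, integral_finsetSum_measure fun j _ => hi _]
    · rw [ENNReal.toReal_ofReal (inv_nonneg.2 hR.le), smul_eq_mul]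
      congr 2
      · refine Finset.sum_congr rfl fun c _ => ?_
        rw [integral_finsetSum_measure fun c' _ => hi' c c']
        refine Finset.sum_congr rfl fun c' _ => ?_
        rw [integral_smul_measure, integral_dirac, smul_eq_mul, ENNReal.toReal_mul,
          ENNReal.toReal_mul, ENNReal.coe_toReal]
      · simp
    · exact fun c _ => integrable_finsetSum_measure.2 fun c' _ => hi' c c'
    · exact integrable_finsetSum_measure.2 fun c _ =>
        integrable_finsetSum_measure.2 fun c' _ => hi' c c'
    · exact integrable_finsetSum_measure.2 fun j _ => hi _
  have hone : ∑ c, ∑ c', (π z.1 c).toReal * (π' z.2.1 c').toReal = 1 := by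
    simp_rw [← Finset.mul_sum, sum_toReal_scheme, mul_one, sum_toReal_scheme]
  rw [jumpGenerator, hint, mul_sub, mul_inv_cancel_left₀ hR.ne']
  simp only [mul_sub, Finset.sum_sub_distrib, ← Finset.sum_mul, hone, Finset.sum_const,
    Finset.card_range, nsmul_eq_mul, Finset.mul_sum]
  rw [coupledRate]
  simp only [mul_assoc]
  ring

lemma sum_range_depart (f : Config N → ℝ) (x : Config N) {m : ℕ} (hm : ∑ c, x c ≤ m) :
    ∑ j ∈ Finset.range m, (f (depart x j) - f x) =
      ∑ c, (x c : ℝ) * (f (complete x c) - f x) := by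
  have h1 : ∑ j ∈ Finset.range m, (f (depart x j) - f x) =
      ∑ j ∈ Finset.range (taskList x).length, (f (depart x j) - f x) := by
    symm
    refine Finset.sum_subset (Finset.range_subset_range.2 (by rwa [length_taskList]))
      fun j _ hj => ?_
    rw [depart, List.getElem?_eq_none (by simpa using hj), Option.elim_none, sub_self]
  have h2 := sum_map_taskList x fun c => f (complete x c) - f x
  simp only [nsmul_eq_mul] at h2
  rw [h1, ← h2, Finset.sum_range, ← List.sum_ofFn]
  congr 1
  refine List.ext_getElem (by simp) fun j h3 h4 => ?_
  simp [depart]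

/-- The first system of the coupling has the dynamics of the scheme `π`. -/
lemma jumpGenerator_coupled_fst (f : Config N → ℝ) (z : CoupledState N) :
    jumpGenerator (coupledRate lam) (coupledKernel lam B π π' n) (fun z => f z.1) z =
      generator lam B π f z.1 := by
  rw [jumpGenerator_coupled, generator]
  congr 1
  · congr 1
    refine Finset.sum_congr rfl fun c _ => ?_
    simp only [coupledArrival]
    rw [← Finset.sum_mul, ← Finset.mul_sum, sum_toReal_scheme, mul_one]
  · exact sum_range_depart f z.1 (by rw [totalTasks]; omega)

/-- The second system of the coupling has the dynamics of the scheme `π'`. -/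
lemma jumpGenerator_coupled_snd (f : Config N → ℝ) (z : CoupledState N) :
    jumpGenerator (coupledRate lam) (coupledKernel lam B π π' n) (fun z => f z.2.1) z =
      generator lam B π' f z.2.1 := by
  rw [jumpGenerator_coupled, generator]
  congr 1
  · congr 1
    rw [Finset.sum_comm]
    refine Finset.sum_congr rfl fun c _ => ?_
    simp only [coupledArrival]
    rw [← Finset.sum_mul, ← Finset.sum_mul, sum_toReal_scheme, one_mul]
  · exact sum_range_depart f z.2.1 (by rw [totalTasks]; omega)

/-- The counter increases at the rate of the counted arrivals. -/
lemma jumpGenerator_coupled_counter {p : ℝ}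
    (hp : ∀ y, ∑ c, (π' y c).toReal * (if n < numShorter y c then 1 else 0) ≤ p) (m : ℕ)
    (z : CoupledState N) :
    |jumpGenerator (coupledRate lam) (coupledKernel lam B π π' n)
      (fun z => ((min z.2.2 m : ℕ) : ℝ)) z| ≤ lam * p := by
  have hstep : ∀ c c' : Fin N, 0 ≤ ((min (coupledArrival B n z c c').2.2 m : ℕ) : ℝ) -
      (min z.2.2 m : ℕ) ∧ ((min (coupledArrival B n z c c').2.2 m : ℕ) : ℝ) -
      (min z.2.2 m : ℕ) ≤ if n < numShorter z.2.1 c' then 1 else 0 := fun c c' => by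
    rw [sub_nonneg, sub_le_iff_le_add]
    simp only [coupledArrival]
    split_ifs
    · constructor
      · exact_mod_cast (by omega : min z.2.2 m ≤ min (z.2.2 + 1) m)
      · exact_mod_cast (by omega : min (z.2.2 + 1) m ≤ 1 + min z.2.2 m)
    · simp
  rw [jumpGenerator_coupled]
  simp only [coupledDeparture, sub_self, Finset.sum_const_zero, add_zero]
  have h0 : ∀ c c', 0 ≤ (π z.1 c).toReal * (π' z.2.1 c').toReal := fun c c' =>
    mul_nonneg ENNReal.toReal_nonneg ENNReal.toReal_nonneg
  rw [abs_of_nonneg (mul_nonneg (NNReal.coe_nonneg lam) (Finset.sum_nonneg fun c _ => Finset.sum_nonneg fun c' _ =>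
    mul_nonneg (h0 c c') (hstep c c').1))]
  refine mul_le_mul_of_nonneg_left ?_ (NNReal.coe_nonneg lam)
  calc _ ≤ ∑ c, ∑ c', (π z.1 c).toReal * (π' z.2.1 c').toReal *
        (if n < numShorter z.2.1 c' then 1 else 0) :=
        Finset.sum_le_sum fun c _ => Finset.sum_le_sum fun c' _ =>
          mul_le_mul_of_nonneg_left (hstep c c').2 (h0 c c')
    _ = ∑ c', (π' z.2.1 c').toReal * (if n < numShorter z.2.1 c' then 1 else 0) := by
        simp_rw [mul_assoc, ← Finset.mul_sum]
        rw [← Finset.sum_mul, sum_toReal_scheme, one_mul]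
    _ ≤ p := hp _

lemma generator_bounded (π : Scheme N) {f : Config N → ℝ} (hf : f.support.Finite) :
    ∃ C D : ℝ, (∀ x, |f x| ≤ C) ∧ ∀ x, |generator lam B π f x| ≤ D := by
  obtain ⟨C, hC⟩ := (hf.image fun x => |f x|).bddAbove
  obtain ⟨m, hm⟩ := (hf.image fun x => ∑ c, x c).bddAbove
  have hC0 : ∀ x, |f x| ≤ max C 0 := fun x => by
    by_cases hx : f x = 0
    · simp [hx]
    · exact le_max_of_le_left (hC ⟨x, hx, rfl⟩)
  have hm0 : ∀ x : Config N, m < ∑ c, x c → f x = 0 := fun x hx => by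
    by_contra h
    exact absurd (hm ⟨x, h, rfl⟩) (not_le.2 hx)
  set C' := max C 0
  have hC' : 0 ≤ C' := le_max_right _ _
  have hdiff : ∀ x y, |f x - f y| ≤ 2 * C' := fun x y =>
    (abs_sub _ _).trans (by linarith [hC0 x, hC0 y])
  refine ⟨C', lam * (2 * C') + (m + 1 : ℕ) * (2 * C'), hC0, fun x => ?_⟩
  have h1 : |(lam : ℝ) * ∑ c, (π x c).toReal * (f (addTask B x c) - f x)| ≤ lam * (2 * C') := by
    rw [abs_mul, abs_of_nonneg (NNReal.coe_nonneg lam)]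
    refine mul_le_mul_of_nonneg_left ((Finset.abs_sum_le_sum_abs _ _).trans ?_) (NNReal.coe_nonneg lam)
    calc _ ≤ ∑ c, (π x c).toReal * (2 * C') := Finset.sum_le_sum fun c _ => by
          rw [abs_mul, abs_of_nonneg ENNReal.toReal_nonneg]
          exact mul_le_mul_of_nonneg_left (hdiff _ _) ENNReal.toReal_nonneg
      _ = 2 * C' := by rw [← Finset.sum_mul, sum_toReal_scheme, one_mul]
  have h2 : |∑ c, (x c : ℝ) * (f (complete x c) - f x)| ≤ (m + 1 : ℕ) * (2 * C') := by
    rcases lt_or_ge (m + 1) (∑ c, x c) with hx | hx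
    · have : ∑ c, (x c : ℝ) * (f (complete x c) - f x) = 0 :=
        Finset.sum_eq_zero fun c _ => by
          have := sum_complete_add_one x c
          rw [hm0 x (by omega), hm0 (complete x c) (by omega), sub_self, mul_zero]
      rw [this, abs_zero]; positivity
    · refine (Finset.abs_sum_le_sum_abs _ _).trans ?_
      calc _ ≤ ∑ c, (x c : ℝ) * (2 * C') := Finset.sum_le_sum fun c _ => by
            rw [abs_mul, abs_of_nonneg (Nat.cast_nonneg _)]
            exact mul_le_mul_of_nonneg_left (hdiff _ _) (Nat.cast_nonneg _)
        _ = (∑ c, x c : ℕ) * (2 * C') := by rw [← Finset.sum_mul]; push_cast; rfl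
        _ ≤ _ := by gcongr
  exact (abs_add_le _ _).trans (add_le_add h1 h2)

end Coupling

/-- The coupling of a JSQ policy `π` and a scheme `π'`, on a probability space of its own. If `p`
bounds the probability that `π'` chooses a pool with more than `n` shorter ones, then the
occupancies differ by more than `i * n + m` with probability at most `lam * p * T / m`. -/
theorem exists_coupling {N : ℕ} (lam : ℝ≥0) (B : ℕ∞) (ν : Measure (Config N))
    [IsProbabilityMeasure ν] (hν : ∀ᵐ x ∂ν, ∀ c, (x c : ℕ∞) ≤ B) (π π' : Scheme N)
    (hπ : IsJSQ π) (n : ℕ) {p : ℝ} (hp0 : 0 ≤ p)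
    (hp : ∀ y, ∑ c, (π' y c).toReal * (if n < numShorter y c then 1 else 0) ≤ p) :
    ∃ (Ω : Type) (_ : MeasurableSpace Ω) (P : Measure Ω) (_ : IsProbabilityMeasure P)
      (X Y : ℝ≥0 → Ω → Config N), IsTaskProcess P lam B π ν X ∧ IsTaskProcess P lam B π' ν Y ∧
      ∀ (T : ℝ≥0) (m : ℕ), 0 < m → ∃ E : Set Ω, P E ≤ ENNReal.ofReal (lam * p * T / m) ∧
        ∀ᵐ ω ∂P, ω ∉ E → ∀ t ≤ T, ∀ i, 1 ≤ i →
          |(occupancy i (X t ω) : ℝ) - occupancy i (Y t ω)| ≤ i * n + m := by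
  let ι : Config N → CoupledState N := fun x => (x, x, 0)
  have hι : Measurable ι := measurable_of_countable ι
  have : IsProbabilityMeasure (ν.map ι) := Measure.isProbabilityMeasure_map hι.aemeasurable
  obtain ⟨Ω, mΩ, P, hP, Z, ℱ, hmeas, hright, hleft, hinit, hrel, hmart⟩ :=
    exists_jumpProcess (ν.map ι) (coupledKernel lam B π π' n) (coupledRate_pos lam)
      (c := 2) zero_le_two (fun z => ae_coupledKernel lam B π π' n (fun c c' _ => by
        have h1 := sum_addTask_le B z.1 c
        have h2 := sum_addTask_le B z.2.1 c'
        have h3 : totalTasks (coupledArrival B n z c c') ≤ totalTasks z + 2 := by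
          simp only [totalTasks, coupledArrival]; omega
        have h4 : (totalTasks (coupledArrival B n z c c') : ℝ) ≤ totalTasks z + 2 := by
          exact_mod_cast h3
        simp only [coupledRate]; push_cast; linarith) fun j => by
        have h3 : totalTasks (coupledDeparture z j) ≤ totalTasks z :=
          add_le_add (Finset.sum_le_sum fun c _ => depart_le _ _ _)
            (Finset.sum_le_sum fun c _ => depart_le _ _ _)
        have h4 : (totalTasks (coupledDeparture z j) : ℝ) ≤ totalTasks z := by exact_mod_cast h3
        simp only [coupledRate]; push_cast; linarith)
  have hmZ : ∀ t, Measurable (Z t) := fun t => (hmeas t).mono (ℱ.le t) le_rfl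
  have hinit' : ∀ᵐ ω ∂P, ∃ x, (∀ c, (x c : ℕ∞) ≤ B) ∧ Z 0 ω = ι x := by
    refine ae_of_ae_map (p := fun z => ∃ x, (∀ c, (x c : ℕ∞) ≤ B) ∧ z = ι x)
      (hmZ 0).aemeasurable ?_
    rw [hinit, ae_map_iff hι.aemeasurable (Set.to_countable _).measurableSet]
    filter_upwards [hν] with x hx using ⟨x, hx, rfl⟩
  have hsand : ∀ᵐ ω ∂P, ∀ t, Sandwiched B n (Z t ω) := by
    have h := hrel (fun z z' => Sandwiched B n z → Sandwiched B n z') (fun z => id)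
      (fun a b c h1 h2 h => h2 (h1 h)) fun z => ae_coupledKernel lam B π π' n
        (fun c c' hc h => h.addTask (hπ z.1 c ((PMF.mem_support_iff _ _).2 hc)))
        fun j h => h.depart j
    filter_upwards [h, hinit'] with ω h1 ⟨x, hx, h2⟩ t
    refine h1 0 t zero_le ?_
    rw [h2]
    exact ⟨hx, hx, fun k => ⟨le_rfl, by simp [ι]⟩⟩
  have hcount : ∀ᵐ ω ∂P, ∀ s t, s ≤ t → (Z s ω).2.2 ≤ (Z t ω).2.2 :=
    hrel (fun z z' => z.2.2 ≤ z'.2.2) (fun z => le_rfl) (fun a b c => le_trans) fun z =>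
      ae_coupledKernel lam B π π' n (fun c c' _ => Nat.le_add_right _ _) fun j => le_rfl
  have hproc : ∀ (σ : Scheme N) (q : CoupledState N → Config N), (∀ x, q (ι x) = x) →
      (∀ (f : Config N → ℝ) z, jumpGenerator (coupledRate lam) (coupledKernel lam B π π' n)
        (fun z => f (q z)) z = generator lam B σ f (q z)) →
      IsTaskProcess P lam B σ ν fun t ω => q (Z t ω) := fun σ q hq hgen => by
    have hqm : Measurable q := measurable_of_countable q
    refine ⟨fun t => hqm.comp (hmZ t), ?_, ?_, ?_, ℱ, fun t => hqm.comp (hmeas t), ?_⟩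
    · filter_upwards [hright] with ω h t
      exact (h t).mono fun s hs => by rw [hs]
    · filter_upwards [hleft] with ω h t ht
      obtain ⟨z, hz⟩ := h t ht
      exact ⟨q z, hz.mono fun s hs => by rw [hs]⟩
    · have h1 : (fun ω => q (Z 0 ω)) = q ∘ Z 0 := rfl
      have h2 : q ∘ ι = id := funext hq
      rw [h1, ← Measure.map_map hqm (hmZ 0), hinit, Measure.map_map hqm hι, h2, Measure.map_id]
    · intro f hf
      obtain ⟨C, D, hC, hD⟩ := generator_bounded lam B σ hf
      have h := hmart (fun z => f (q z)) C D (fun z => hC _) fun z => by rw [hgen]; exact hD _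
      simpa only [hgen] using h
  refine ⟨Ω, mΩ, P, hP, fun t ω => (Z t ω).1, fun t ω => (Z t ω).2.1,
    hproc π Prod.fst (fun _ => rfl) (jumpGenerator_coupled_fst lam B π π' n),
    hproc π' (fun z => z.2.1) (fun _ => rfl) (jumpGenerator_coupled_snd lam B π π' n),
    fun T m hm => ?_⟩
  refine ⟨{ω | m ≤ (Z T ω).2.2}, ?_, ?_⟩
  · set F : CoupledState N → ℝ := fun z => ((min z.2.2 m : ℕ) : ℝ) with hF
    have hFm : Measurable F := measurable_of_countable F
    have hFb : ∀ z, |F z| ≤ m := fun z => by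
      simp only [hF]; rw [abs_of_nonneg (Nat.cast_nonneg _)]
      exact_mod_cast min_le_right _ _
    have hGb := jumpGenerator_coupled_counter lam B π π' n hp m
    have hM := hmart F m (lam * p) hFb hGb
    have hFi : ∀ t, Integrable (fun ω => F (Z t ω)) P := fun t =>
      Integrable.of_bound (hFm.comp (hmZ t)).aestronglyMeasurable m
        (Eventually.of_forall fun ω => hFb _)
    -- the counter starts from zero, and its martingale has constant expectation
    have hexp : ∫ ω, F (Z T ω) ∂P ≤ lam * p * T := by
      have h1 := hM.setIntegral_eq (i := 0) (j := T) zero_le MeasurableSet.univ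
      simp only [setIntegral_univ, NNReal.coe_zero, intervalIntegral.integral_same,
        sub_zero] at h1
      have h2 : ∫ ω, F (Z 0 ω) ∂P = 0 := integral_eq_zero_of_ae (by
        filter_upwards [hinit'] with ω ⟨x, _, hx⟩
        simp [hx, ι, hF])
      have h3 : ∫ ω, (F (Z T ω) - lam * p * T) ∂P ≤ ∫ ω, (F (Z T ω) - ∫ s in (0 : ℝ)..T,
          jumpGenerator (coupledRate lam) (coupledKernel lam B π π' n) F
            (Z s.toNNReal ω)) ∂P := by
        refine integral_mono ((hFi T).sub (integrable_const _)) (hM.integrable T) fun ω => ?_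
        have h4 := intervalIntegral.norm_integral_le_of_norm_le_const (a := 0) (b := (T : ℝ))
          (C := lam * p) (f := fun s => jumpGenerator (coupledRate lam)
            (coupledKernel lam B π π' n) F (Z s.toNNReal ω)) fun s _ => hGb _
        rw [sub_zero, abs_of_nonneg (NNReal.coe_nonneg T)] at h4
        have h5 := (le_abs_self _).trans h4
        dsimp only
        linarith
      rw [← h1, h2, integral_sub (hFi T) (integrable_const _)] at h3
      simp at h3
      linarith
    have hmark := mul_meas_ge_le_integral_of_nonneg (μ := P) (f := fun ω => F (Z T ω))
      (Eventually.of_forall fun ω => Nat.cast_nonneg _) (hFi T) m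
    have hset : {ω | (m : ℝ) ≤ F (Z T ω)} = {ω | m ≤ (Z T ω).2.2} := by
      ext ω
      simp only [Set.mem_ofPred_eq, hF, Nat.cast_le, le_min_iff, le_refl, and_true]
    rw [hset] at hmark
    have hm' : (0 : ℝ) < m := by exact_mod_cast hm
    refine (ENNReal.le_ofReal_iff_toReal_le (measure_ne_top _ _) (by positivity)).2 ?_
    rw [le_div_iff₀ hm', mul_comm]
    exact hmark.trans hexp
  · filter_upwards [hsand, hcount] with ω h1 h2 hE t ht i hi
    have h3 : (Z t ω).2.2 ≤ m := (h2 t T ht).trans (not_le.1 hE).le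
    have h3' : ((Z t ω).2.2 : ℝ) ≤ m := by exact_mod_cast h3
    have := (h1 t).abs_sub_le hi
    linarith

/-! ### Sampling misses the shortest pools -/

section SamplingBound

variable {N d : ℕ}

lemma descFactorial_mul_pow_le {a N : ℕ} (h : a ≤ N) (d : ℕ) :
    a.descFactorial d * N ^ d ≤ a ^ d * N.descFactorial d := by
  induction d with
  | zero => simp
  | succ d ih =>
    have h1 : (a - d) * N ≤ a * (N - d) := by
      rw [Nat.sub_mul, Nat.mul_sub]
      have := Nat.mul_le_mul_left d h
      rw [mul_comm d a] at this
      omega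
    calc a.descFactorial (d + 1) * N ^ (d + 1)
        = ((a - d) * N) * (a.descFactorial d * N ^ d) := by
          rw [Nat.descFactorial_succ, pow_succ]; ring
      _ ≤ (a * (N - d)) * (a ^ d * N.descFactorial d) := Nat.mul_le_mul h1 ih
      _ = _ := by rw [Nat.descFactorial_succ, pow_succ]; ring

open Classical in
/-- All sampled pools belong to a given set with at most the probability that this has for
sampling with replacement. -/
lemma sum_prob_forall_mem_le (s : Sampling) (hN : 0 < N) (hd : s = .withoutReplacement → d ≤ N)
    (A : Finset (Fin N)) :
    ∑ u : Fin d → Fin N, s.prob u * (if ∀ j, u j ∈ A then 1 else 0) ≤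
      ((A.card : ℝ≥0∞) / N) ^ d := by
  have hN0 : (N : ℝ≥0∞) ≠ 0 := by exact_mod_cast hN.ne'
  have hNt : (N : ℝ≥0∞) ≠ ∞ := ENNReal.natCast_ne_top N
  cases s with
  | withReplacement =>
    have hcard : (Finset.univ.filter fun u : Fin d → Fin N => ∀ j, u j ∈ A).card =
        A.card ^ d := by
      have : (Finset.univ.filter fun u : Fin d → Fin N => ∀ j, u j ∈ A) =
          Fintype.piFinset fun _ => A := by ext u; simp
      rw [this, Fintype.card_piFinset_const]
    simp only [Sampling.prob]
    rw [← Finset.mul_sum, Finset.sum_boole, hcard, Nat.cast_pow, ENNReal.div_eq_inv_mul, mul_pow,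
      ENNReal.inv_pow]
  | withoutReplacement =>
    have hcard : (Finset.univ.filter fun u : Fin d → Fin N =>
        Function.Injective u ∧ ∀ j, u j ∈ A).card = A.card.descFactorial d := by
      have h1 := Fintype.card_embedding_eq (α := Fin d) (β := A)
      rw [Fintype.card_fin, Fintype.card_coe] at h1
      rw [← h1, ← Fintype.card_subtype]
      refine Fintype.card_congr
        ⟨fun u => ⟨fun j => ⟨u.1 j, u.2.2 j⟩, fun i j hij => u.2.1 (by simpa using hij)⟩,
          fun e => ⟨fun j => (e j).1, fun i j hij => e.injective (Subtype.ext hij),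
            fun j => (e j).2⟩, fun u => rfl, fun e => rfl⟩
    have hsum : ∑ u : Fin d → Fin N, Sampling.prob .withoutReplacement u *
        (if ∀ j, u j ∈ A then 1 else 0) =
        (N.descFactorial d : ℝ≥0∞)⁻¹ * (A.card.descFactorial d : ℝ≥0∞) := by
      rw [← hcard, ← Finset.sum_boole, Finset.mul_sum]
      refine Finset.sum_congr rfl fun u _ => ?_
      simp only [Sampling.prob]
      by_cases h1 : Function.Injective u <;> simp [h1]
    have hD0 : (N.descFactorial d : ℝ≥0∞) ≠ 0 := by
      have := Nat.descFactorial_pos.2 (hd rfl)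
      exact_mod_cast this.ne'
    have hle := descFactorial_mul_pow_le (by simpa using A.card_le_univ : A.card ≤ N) d
    have hle' : (A.card.descFactorial d : ℝ≥0∞) * (N : ℝ≥0∞) ^ d ≤
        (A.card : ℝ≥0∞) ^ d * N.descFactorial d := by exact_mod_cast hle
    rw [hsum, mul_comm, ← div_eq_mul_inv, ENNReal.div_le_iff hD0 (ENNReal.natCast_ne_top _),
      div_eq_mul_inv, mul_pow, ← ENNReal.inv_pow, mul_right_comm, ← div_eq_mul_inv,
      ENNReal.le_div_iff_mul_le (Or.inl (pow_ne_zero _ hN0)) (Or.inl (ENNReal.pow_ne_top hNt))]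
    exact hle'

/-- The JSQ(`d`) scheme sends a task to a pool with more than `n` shorter ones with exponentially
small probability: all sampled pools have to avoid a set of more than `n` pools. -/
lemma IsJSQd.sum_numShorter_le {s : Sampling} {π : Scheme N} (hπ : IsJSQd s d π) (hN : 0 < N)
    (hd : s = .withoutReplacement → d ≤ N) (n : ℕ) (y : Config N) :
    ∑ c, (π y c).toReal * (if n < numShorter y c then 1 else 0) ≤
      Real.exp (-(n * d / N)) := by
  classical
  by_cases hex : ∃ c, n < numShorter y c
  swap
  · have h0 : ∑ c, (π y c).toReal * (if n < numShorter y c then 1 else 0) = 0 :=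
      Finset.sum_eq_zero fun c _ => by rw [if_neg fun h => hex ⟨c, h⟩, mul_zero]
    rw [h0]; exact (Real.exp_pos _).le
  obtain ⟨choice, hch, hπc⟩ := hπ
  -- the lowest level `v` such that more than `n` pools are at this level or below
  have hv : ∃ v, n < (Finset.univ.filter fun p => y p ≤ v).card := by
    obtain ⟨c, hc⟩ := hex
    exact ⟨y c, hc.trans_le (Finset.card_le_card fun p => by
      simp only [Finset.mem_filter, Finset.mem_univ, true_and]; exact le_of_lt)⟩
  set v := Nat.find hv with hvdef
  have hgood : ∀ c, y c ≤ v → numShorter y c ≤ n := fun c hc => by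
    by_contra! hlt
    have hpos : 0 < y c := by
      by_contra h0
      have : numShorter y c = 0 := by
        rw [numShorter, Finset.card_eq_zero, Finset.filter_eq_empty_iff]
        intro p _; omega
      omega
    refine Nat.find_min hv (m := y c - 1) (by omega) (hlt.trans_le (Finset.card_le_card ?_))
    intro p
    simp only [Finset.mem_filter, Finset.mem_univ, true_and]
    omega
  set A : Finset (Fin N) := Finset.univ.filter fun p => ¬ y p ≤ v with hA
  have hAcard : A.card + n ≤ N := by
    have h1 := Finset.card_filter_add_card_filter_not (s := (Finset.univ : Finset (Fin N)))
      (fun p => y p ≤ v)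
    have h2 : n < (Finset.univ.filter fun p => y p ≤ v).card := Nat.find_spec hv
    rw [Finset.card_univ, Fintype.card_fin, ← hA] at h1
    omega
  have hbound : ∑ c, π y c * (if n < numShorter y c then 1 else 0) ≤
      ((A.card : ℝ≥0∞) / N) ^ d := by
    refine le_trans ?_ (sum_prob_forall_mem_le s hN hd A)
    simp only [hπc, Finset.sum_mul]
    rw [Finset.sum_comm]
    refine Finset.sum_le_sum fun u _ => ?_
    simp_rw [mul_assoc]
    rw [← Finset.mul_sum]
    refine mul_le_mul_right ?_ _
    split_ifs with hu
    · refine (Finset.sum_le_sum fun c _ => ?_).trans_eq (sum_scheme (fun _ => choice y u) y)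
      split_ifs <;> simp
    · refine le_of_eq (Finset.sum_eq_zero fun c _ => ?_)
      by_cases hc : choice y u c = 0
      · rw [hc, zero_mul]
      · obtain ⟨j, hj⟩ := not_forall.1 hu
        have h1 := (hch y u c ((PMF.mem_support_iff _ _).2 hc)).2 j
        have h2 : y (u j) ≤ v := by simpa [hA] using hj
        rw [if_neg (not_lt.2 (hgood c (h1.trans h2))), mul_zero]
  have hreal : ∑ c, (π y c).toReal * (if n < numShorter y c then 1 else 0) =
      (∑ c, π y c * (if n < numShorter y c then 1 else 0)).toReal := by
    rw [ENNReal.toReal_sum]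
    · refine Finset.sum_congr rfl fun c _ => ?_
      split_ifs <;> simp
    · intro c _
      split_ifs <;> simp [(π y).apply_ne_top c]
  have hN' : (0 : ℝ) < N := by exact_mod_cast hN
  have hfin : ((A.card : ℝ≥0∞) / N) ^ d ≠ ∞ :=
    ENNReal.pow_ne_top (ENNReal.div_ne_top (ENNReal.natCast_ne_top _) (by exact_mod_cast hN.ne'))
  have hfrac : (A.card : ℝ) / N ≤ Real.exp (-(n / N)) := by
    have h1 : (A.card : ℝ) + n ≤ N := by exact_mod_cast hAcard
    have h2 : (A.card : ℝ) / N ≤ -(n / N) + 1 := by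
      rw [div_le_iff₀ hN']
      field_simp
      linarith
    exact h2.trans (Real.add_one_le_exp _)
  calc _ = (∑ c, π y c * (if n < numShorter y c then 1 else 0)).toReal := hreal
    _ ≤ (((A.card : ℝ≥0∞) / N) ^ d).toReal := ENNReal.toReal_mono hfin hbound
    _ = ((A.card : ℝ) / N) ^ d := by simp
    _ ≤ Real.exp (-(n / N)) ^ d := by gcongr
    _ = Real.exp (-(n * d / N)) := by
      rw [← Real.exp_nat_mul]; congr 1; ring

end SamplingBound

/-! ### Alikeness -/

/-- A task process remains one when its probability space is enlarged. -/
lemma IsTaskProcess.comp_measurePreserving {N : ℕ} {Ω Ω' : Type*} [mΩ : MeasurableSpace Ω]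
    [mΩ' : MeasurableSpace Ω'] {P : Measure Ω} {P' : Measure Ω'} [IsProbabilityMeasure P]
    [IsProbabilityMeasure P'] {lam : ℝ≥0} {B : ℕ∞} {π : Scheme N} {ν : Measure (Config N)}
    {X : ℝ≥0 → Ω → Config N} (hX : IsTaskProcess P lam B π ν X) {φ : Ω' → Ω}
    (hφ : MeasurePreserving φ P' P) : IsTaskProcess P' lam B π ν fun t ω => X t (φ ω) := by
  obtain ⟨ℱ, hadapt, hmart⟩ := hX.martingale
  let ℱ' : Filtration ℝ≥0 mΩ' :=
    { seq := fun t => (ℱ t).comap φ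
      mono' := fun s t hst => MeasurableSpace.comap_mono (ℱ.mono hst)
      le' := fun t => (MeasurableSpace.comap_mono (ℱ.le t)).trans hφ.measurable.comap_le }
  have hcomap : ∀ t, Measurable[ℱ' t, ℱ t] φ := fun t => comap_measurable φ
  refine ⟨fun t => (hX.measurable t).comp hφ.measurable,
    hφ.quasiMeasurePreserving.ae hX.rightCont, hφ.quasiMeasurePreserving.ae hX.leftLim, ?_, ℱ',
    fun t => (hadapt t).comp (hcomap t), fun f hf => ?_⟩
  · have : (fun ω => X 0 (φ ω)) = X 0 ∘ φ := rfl
    rw [this, ← Measure.map_map (hX.measurable 0) hφ.measurable, hφ.map_eq, hX.init]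
  · have hM := hmart f hf
    set M : ℝ≥0 → Ω → ℝ := fun t ω =>
      f (X t ω) - ∫ s in (0 : ℝ)..t, generator lam B π f (X s.toNNReal ω) with hMdef
    change Martingale (fun t ω => M t (φ ω)) ℱ' P'
    have hsm : ∀ t, StronglyMeasurable[ℱ' t] fun ω => M t (φ ω) := fun t =>
      (hM.stronglyAdapted t).comp_measurable (hcomap t)
    have hint : ∀ t, Integrable (fun ω => M t (φ ω)) P' := fun t =>
      hφ.integrable_comp_of_integrable (hM.integrable t)
    refine ⟨hsm, fun s t hst => ?_⟩
    symm
    refine ae_eq_condExp_of_forall_setIntegral_eq (ℱ'.le s) (hint t)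
      (fun _ _ _ => (hint s).integrableOn) ?_ (hsm s).aestronglyMeasurable
    rintro _ ⟨A, hA, rfl⟩ -
    have hA' : MeasurableSet A := ℱ.le s A hA
    have h1 : ∀ t, ∫ ω in φ ⁻¹' A, M t (φ ω) ∂P' = ∫ ω in A, M t ω ∂P := fun t => by
      rw [← hφ.map_eq, setIntegral_map hA' (by
        rw [hφ.map_eq]; exact (hM.integrable t).aestronglyMeasurable) hφ.measurable.aemeasurable]
    rw [h1, h1]
    exact hM.setIntegral_eq hst hA

/-- Criterion for alikeness. The coupling is used with `n = ⌈h N⌉`: the first limit makes `n`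
negligible, and the second one makes the number of tasks that JSQ(`d`) does not send to one of
the `n` shortest pools negligible. -/
theorem alike_of_tendsto
    (lam : ℕ → ℝ≥0) (lam₀ : ℝ≥0)
    (hlam : Tendsto (fun N => (lam N : ℝ) / N) atTop (𝓝 (lam₀ : ℝ)))
    (B : ℕ∞) (ν : ∀ N, Measure (Config N)) [∀ N, IsProbabilityMeasure (ν N)]
    (hν : ∀ N, ∀ᵐ x ∂(ν N), ∀ c, (x c : ℕ∞) ≤ B) (s : Sampling) (d : ℕ → ℕ)
    (hd : ∀ N, 1 ≤ N → 1 ≤ d N ∧ (s = .withoutReplacement → d N ≤ N))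
    (π π' : ∀ N [NeZero N], Scheme N) (hπ : ∀ N [NeZero N], IsJSQ (π N))
    (hπ' : ∀ N [NeZero N], IsJSQd s (d N) (π' N))
    (g : ℕ → ℝ) (hg : Tendsto g atTop atTop) (h : ℕ → ℝ) (hh0 : ∀ᶠ N in atTop, 0 ≤ h N)
    (hhg : Tendsto (fun N => h N / g N) atTop (𝓝 0))
    (hexp : Tendsto (fun N : ℕ => N / g N * Real.exp (-(h N * d N / N))) atTop (𝓝 0)) :
    Alike g lam B ν π π' := by
  set n : ℕ → ℕ := fun N => ⌈h N⌉₊ with hn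
  set p : ℕ → ℝ := fun N => Real.exp (-(n N * d N / N)) with hp
  have hcoup : ∀ N, ∃ (Ω : Type) (_ : MeasurableSpace Ω) (P : Measure Ω)
      (_ : IsProbabilityMeasure P) (X Y : ℝ≥0 → Ω → Config N), ∀ [NeZero N],
      (IsTaskProcess P (lam N) B (π N) (ν N) X ∧ IsTaskProcess P (lam N) B (π' N) (ν N) Y) ∧
      ∀ (T : ℝ≥0) (m : ℕ), 0 < m → ∃ E : Set Ω, P E ≤ ENNReal.ofReal (lam N * p N * T / m) ∧
        ∀ᵐ ω ∂P, ω ∉ E → ∀ t ≤ T, ∀ i, 1 ≤ i →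
          |(occupancy i (X t ω) : ℝ) - occupancy i (Y t ω)| ≤ i * n N + m := fun N => by
    rcases Nat.eq_zero_or_pos N with hN | hN
    · exact ⟨Unit, inferInstance, Measure.dirac (), inferInstance, fun _ _ _ => 0,
        fun _ _ _ => 0, fun {hne} => absurd hN hne.out⟩
    · have : NeZero N := ⟨hN.ne'⟩
      obtain ⟨Ω, mΩ, P, hP, X, Y, h1, h2, h3⟩ := exists_coupling (lam N) B (ν N) (hν N) (π N)
        (π' N) (hπ N) (n N) (Real.exp_pos _).le
        ((hπ' N).sum_numShorter_le hN (hd N hN).2 (n N))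
      exact ⟨Ω, mΩ, P, hP, X, Y, fun {_} => ⟨⟨h1, h2⟩, h3⟩⟩
  choose Ω mΩ P hP X Y hXY using hcoup
  have hproj : ∀ N, MeasurePreserving (Function.eval N) (Measure.infinitePi P) (P N) :=
    fun N => measurePreserving_eval_infinitePi P N
  refine ⟨∀ N, Ω N, inferInstance, Measure.infinitePi P, inferInstance,
    fun N t ω => X N t (ω N), fun N t ω => Y N t (ω N), fun N hN =>
      ⟨(hXY N).1.1.comp_measurePreserving (hproj N), (hXY N).1.2.comp_measurePreserving (hproj N)⟩,
    fun T i hi => ?_⟩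
  rw [tendstoInMeasure_iff_norm]
  intro ε hε
  -- the probability that more than `ε g / 4` tasks are sent to longer pools
  have hlim : Tendsto (fun N : ℕ => ENNReal.ofReal (4 * T / ε * ((lam N / N) *
      (N / g N * Real.exp (-(h N * d N / N)))))) atTop (𝓝 0) := by
    have h1 := (hlam.mul hexp).const_mul (4 * T / ε)
    rw [mul_zero, mul_zero] at h1
    simpa using ENNReal.tendsto_ofReal h1
  refine tendsto_of_tendsto_of_tendsto_of_le_of_le' tendsto_const_nhds hlim
    (Eventually.of_forall fun _ => bot_le) ?_
  have hsmall : ∀ᶠ N in atTop, (i : ℝ) * (h N / g N) < ε / 4 := by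
    have h1 := hhg.const_mul (i : ℝ)
    rw [mul_zero] at h1
    exact h1.eventually_lt_const (by positivity)
  filter_upwards [eventually_ge_atTop 1, hg.eventually_gt_atTop 0,
    hg.eventually_gt_atTop ((4 * i + 4) / ε), hsmall, hh0] with N hN hg0 hgε hih hh0
  have hNe : NeZero N := ⟨by omega⟩
  set m : ℕ := ⌈ε * g N / 4⌉₊ with hm
  have hm1 : ε * g N / 4 ≤ m := Nat.le_ceil _
  have hm2 : (m : ℝ) < ε * g N / 4 + 1 := Nat.ceil_lt_add_one (by positivity)
  have hm0 : 0 < m := Nat.ceil_pos.2 (by positivity)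
  have hn2 : (n N : ℝ) < h N + 1 := Nat.ceil_lt_add_one hh0
  obtain ⟨-, hE⟩ := hXY N
  obtain ⟨E, hPE, hE⟩ := hE T m hm0
  have hsub : ∀ᵐ ω ∂(Measure.infinitePi P), ω N ∉ E → ∀ t ≤ T, ∀ i, 1 ≤ i →
      |(occupancy i (X N t (ω N)) : ℝ) - occupancy i (Y N t (ω N))| ≤ i * n N + m :=
    (hproj N).quasiMeasurePreserving.ae hE
  have hlt : (i : ℝ) * n N + m < ε * g N := by
    have h1 : (i : ℝ) * n N ≤ i * (h N + 1) := by gcongr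
    have h2 : (i : ℝ) * h N < ε / 4 * g N := by
      rw [← mul_div_assoc, div_lt_iff₀ hg0] at hih; exact hih
    rw [div_lt_iff₀ hε] at hgε
    nlinarith
  have hfin : lam N * p N * T / m ≤ 4 * T / ε * ((lam N / N) *
      (N / g N * Real.exp (-(h N * d N / N)))) := by
    have hN0 : (0 : ℝ) < N := by exact_mod_cast hN
    have h1 : p N ≤ Real.exp (-(h N * d N / N)) := by
      have : h N ≤ n N := Nat.le_ceil _
      refine Real.exp_le_exp.2 (neg_le_neg ?_)
      gcongr
    have h2 : (0 : ℝ) < ε * g N / 4 := by positivity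
    calc lam N * p N * T / m
        ≤ lam N * Real.exp (-(h N * d N / N)) * T / (ε * g N / 4) := by gcongr
      _ = _ := by field_simp
  calc _ ≤ Measure.infinitePi P (Function.eval N ⁻¹' E) := by
        refine measure_mono_ae ?_
        filter_upwards [hsub] with ω hω hmem
        by_contra hout
        have h1 := hω hout
        have h2 : (⨆ t : Set.Iic T, |(occupancy i (X N t (ω N)) : ℝ) -
            occupancy i (Y N t (ω N))|) ≤ i * n N + m :=
          Real.iSup_le (fun t => h1 t t.2 i hi) (by positivity)
        have h3 : 0 ≤ ⨆ t : Set.Iic T, |(occupancy i (X N t (ω N)) : ℝ) -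
            occupancy i (Y N t (ω N))| := Real.iSup_nonneg fun _ => abs_nonneg _
        have h4 : ε ≤ ‖(⨆ t : Set.Iic T, |(occupancy i (X N t (ω N)) : ℝ) -
            occupancy i (Y N t (ω N))|) / g N - 0‖ := hmem
        rw [sub_zero, Real.norm_of_nonneg (div_nonneg h3 hg0.le), le_div_iff₀ hg0] at h4
        linarith
    _ ≤ P N E := by
        rw [← (hproj N).map_eq]
        exact Measure.le_map_apply (hproj N).measurable.aemeasurable E
    _ ≤ ENNReal.ofReal (lam N * p N * T / m) := hPE
    _ ≤ _ := ENNReal.ofReal_le_ofReal hfin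

end LoadBalancing

theorem mainTheorem9
    (lam : ℕ → ℝ≥0) (lam₀ : ℝ≥0)
    (hlam : Tendsto (fun N => (lam N : ℝ) / N) atTop (𝓝 (lam₀ : ℝ)))
    (B : ℕ∞)
    (ν : ∀ N, Measure (LoadBalancing.Config N)) [∀ N, IsProbabilityMeasure (ν N)]
    (hν : ∀ N, ∀ᵐ x ∂(ν N), ∀ c, (x c : ℕ∞) ≤ B)
    (s : LoadBalancing.Sampling) (d : ℕ → ℕ)
    (hd : ∀ N, 1 ≤ N → 1 ≤ d N ∧ (s = .withoutReplacement → d N ≤ N))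
    (π π' : ∀ N [NeZero N], LoadBalancing.Scheme N)
    (hπ : ∀ N [NeZero N], LoadBalancing.IsJSQ (π N))
    (hπ' : ∀ N [NeZero N], LoadBalancing.IsJSQd s (d N) (π' N))
    (g : ℕ → ℝ) (hg : Tendsto g atTop atTop) (hgN : ∀ N, g N ≤ N) :
    ((g =Θ[atTop] fun N => (N : ℝ)) → Tendsto d atTop atTop →
      LoadBalancing.Alike g lam B ν π π') ∧
    ((g =o[atTop] fun N => (N : ℝ)) →
      Tendsto (fun N => (d N : ℝ) * ((N / g N) * Real.log (N / g N))⁻¹) atTop atTop →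
      LoadBalancing.Alike g lam B ν π π') := by
  constructor
  · intro hΘ hdinf
    obtain ⟨C, hC⟩ := hΘ.2.bound
    have hbd : ∀ᶠ N : ℕ in atTop, 0 ≤ (N : ℝ) / g N ∧ (N : ℝ) / g N ≤ C := by
      filter_upwards [hC, hg.eventually_gt_atTop 0] with N h1 h2
      rw [Real.norm_of_nonneg (Nat.cast_nonneg N), Real.norm_of_nonneg h2.le] at h1
      exact ⟨by positivity, (div_le_iff₀ h2).2 h1⟩
    have hsqrt : Tendsto (fun N => Real.sqrt (d N)) atTop atTop :=
      Real.tendsto_sqrt_atTop.comp (tendsto_natCast_atTop_atTop.comp hdinf)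
    refine LoadBalancing.alike_of_tendsto lam lam₀ hlam B ν hν s d hd π π' hπ hπ' g hg
      (fun N => N / Real.sqrt (d N)) (Eventually.of_forall fun N => by positivity) ?_ ?_
    · have hz : Tendsto (fun N => C * (Real.sqrt (d N))⁻¹) atTop (𝓝 0) := by
        simpa using hsqrt.inv_tendsto_atTop.const_mul C
      refine squeeze_zero' ?_ ?_ hz
      · filter_upwards [hg.eventually_gt_atTop 0] with N h2
        positivity
      · filter_upwards [hbd] with N h1
        calc (N : ℝ) / Real.sqrt (d N) / g N = N / g N * (Real.sqrt (d N))⁻¹ := by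
              rw [div_right_comm, div_eq_mul_inv]
          _ ≤ _ := mul_le_mul_of_nonneg_right h1.2 (by positivity)
    · have hz : Tendsto (fun N => C * Real.exp (-Real.sqrt (d N))) atTop (𝓝 0) := by
        simpa using (Real.tendsto_exp_neg_atTop_nhds_zero.comp hsqrt).const_mul C
      refine squeeze_zero' ?_ ?_ hz
      · filter_upwards [hg.eventually_gt_atTop 0] with N h2
        positivity
      · filter_upwards [hbd, eventually_ge_atTop 1] with N h1 hN
        have hN0 : (N : ℝ) ≠ 0 := by positivity
        have h2 : (N : ℝ) / Real.sqrt (d N) * d N / N = Real.sqrt (d N) := by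
          rw [div_mul_eq_mul_div, mul_div_assoc, Real.div_sqrt, mul_div_cancel_left₀ _ hN0]
        rw [h2]
        exact mul_le_mul_of_nonneg_right h1.2 (Real.exp_pos _).le
  · intro ho hω
    set r : ℕ → ℝ := fun N => N / g N with hr
    set w : ℕ → ℝ := fun N => d N * (r N * Real.log (r N))⁻¹ with hw
    have hrinf : Tendsto r atTop atTop := by
      have h1 := ho.tendsto_div_nhds_zero
      have h2 : Tendsto (fun N : ℕ => g N / N) atTop (𝓝[>] 0) :=
        tendsto_nhdsWithin_iff.2 ⟨h1, by
          filter_upwards [hg.eventually_gt_atTop 0, eventually_ge_atTop 1] with N h3 h4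
          exact div_pos h3 (by exact_mod_cast h4)⟩
      refine h2.inv_tendsto_nhdsGT_zero.congr fun N => ?_
      simp [hr, inv_div]
    have hsqrt : Tendsto (fun N => Real.sqrt (w N)) atTop atTop :=
      Real.tendsto_sqrt_atTop.comp hω
    refine LoadBalancing.alike_of_tendsto lam lam₀ hlam B ν hν s d hd π π' hπ hπ' g hg
      (fun N => g N / Real.sqrt (w N)) ?_ ?_ ?_
    · filter_upwards [hg.eventually_gt_atTop 0] with N h2
      positivity
    · refine hsqrt.inv_tendsto_atTop.congr' ?_
      filter_upwards [hg.eventually_gt_atTop 0] with N h2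
      simp only [Pi.inv_apply]
      field_simp
    · refine squeeze_zero' ?_ ?_ hrinf.inv_tendsto_atTop
      · filter_upwards [hg.eventually_gt_atTop 0] with N h2
        positivity
      · filter_upwards [hg.eventually_gt_atTop 0, hrinf.eventually_gt_atTop 1,
          hsqrt.eventually_ge_atTop 2, eventually_ge_atTop 1] with N h2 h3 h4 hN
        have hN0 : (0 : ℝ) < N := by exact_mod_cast hN
        have hlog : 0 < Real.log (r N) := Real.log_pos h3
        have hr0 : 0 < r N := by linarith
        have hw0 : 0 < w N := Real.sqrt_pos.1 (by linarith)
        have hdw : (d N : ℝ) = w N * (r N * Real.log (r N)) := by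
          rw [hw]; field_simp
        have hgr : g N / N = (r N)⁻¹ := by rw [hr]; simp
        have hexp : g N / Real.sqrt (w N) * d N / N = Real.sqrt (w N) * Real.log (r N) := by
          calc g N / Real.sqrt (w N) * d N / N
              = g N / N * (w N / Real.sqrt (w N)) * (r N * Real.log (r N)) := by
                rw [hdw]; ring
            _ = _ := by rw [hgr, Real.div_sqrt]; field_simp
        -- `√w ≥ 2` turns the exponential into at most `r⁻²`
        have hle : Real.exp (-(g N / Real.sqrt (w N) * d N / N)) ≤ (r N)⁻¹ * (r N)⁻¹ := by
          rw [hexp]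
          calc Real.exp (-(Real.sqrt (w N) * Real.log (r N)))
              ≤ Real.exp (-Real.log (r N) + -Real.log (r N)) :=
                Real.exp_le_exp.2 (by nlinarith)
            _ = _ := by rw [Real.exp_add, Real.exp_neg, Real.exp_log hr0]
        calc _ ≤ r N * ((r N)⁻¹ * (r N)⁻¹) := mul_le_mul_of_nonneg_left hle hr0.le
          _ = _ := by rw [Pi.inv_apply, mul_inv_cancel_left₀ hr0.ne']
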